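/- Let $n\ge 2$ and let $\Delta_n=\{p\in(0,1)^n : p_1+\dots+p_n=1\}$ be the open unit simplex, with barycenter $\overline e=(\frac1n,\dots,\frac1n)$. For $p,q$ with $\sum_j p_jq_j\neq 0$ write $p\odot q=\big(p_iq_i/\sum_j p_jq_j\big)_{i}$, and for $p\in\Delta_n$ write $p^{-1}=\big((1/p_i)/\sum_j (1/p_j)\big)_{i}$. For $p,q\in\Delta_n$ let $$c(p,q)=\log\Big(\frac1n\sum_{i=1}^n\frac{q_i}{p_i}\Big)-\frac1n\sum_{i=1}^n\log\frac{q_i}{p_i},$$ and for Borel probability measures $P,Q$ on $\Delta_n$ let $\mathbf C(P,Q)=\inf_R\int c\,dR$, the infimum being over all couplings $R$ of $P$ and $Q$. Let $\mathcal L_a$ be the set of Borel probability measures $P$ on $\Delta_n$ that are absolutely continuous with respect to the $(n-1)$-dimensional Lebesgue measure and satisfy $\sum_{i=1}^n\int|\log p_i|\,dP(p)<\infty$. A function $\varphi:\Delta_n\to\mathbb R$ is exponentially concave if $e^{\varphi}$ is concave; at every $r\in\Delta_n$ where $\varphi$ is differentiable (that is, almost everywhere) it generates the portfolio map $(\boldsymbol\pi(r))_i=r_i\,(1+\nabla_{e_i-r}\varphi(r))$,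 $1\le i\le n$, where $e_1,\dots,e_n$ is the standard basis of $\mathbb R^n$ and $\nabla_v$ is the directional derivative. Let $P_0,P_1\in\mathcal L_a$, and let $\varphi_1$ be an exponentially concave function on $\Delta_n$ with portfolio map $\boldsymbol\pi_1$ such that $p\mapsto p\odot\boldsymbol\pi_1(p^{-1})$, which is defined $P_0$-almost everywhere, pushes $P_0$ forward to $P_1$ and is optimal for $\mathbf C(P_0,P_1)$. For $0\le t\le1$ put $\boldsymbol\pi_t=(1-t)\overline e+t\boldsymbol\pi_1$ and $T_t(p)=p\odot\boldsymbol\pi_t(p^{-1})$. The corresponding displacement interpolation is $P_t=(T_t)_\#P_0$, $0\le t\le1$. Then, for every such displacement interpolation, $P_t\in\mathcal L_a$ and $\mathbf C(P_0,P_t)<\infty$ for all $t\in[0,1]$. If moreover $P_0\ne P_1$, then the function $t\mapsto\mathbf C(P_0,P_t)$ is $C^\infty$ on $[0,1)$ (with one-sided derivatives at $t=0$), continuous on $[0,1]$, and strictly increasing and strictly convex on $[0,1]$. -/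

import Mathlib

open MeasureTheory Set
open scoped ENNReal

namespace DirichletTransport

noncomputable section

/-- The open unit simplex in `ℝⁿ`. -/
def openSimplex (n : ℕ) : Set (Fin n → ℝ) :=
  {p | (∀ i, p i ∈ Ioo (0 : ℝ) 1) ∧ ∑ i, p i = 1}

/-- The barycenter `(1/n, …, 1/n)`. -/
def barycenter (n : ℕ) : Fin n → ℝ := fun _ => 1 / (n : ℝ)

/-- The operation `p ⊙ q`: multiply coordinatewise and normalize. -/
def perturb {n : ℕ} (p q : Fin n → ℝ) : Fin n → ℝ :=
  fun i => p i * q i / ∑ j, p j * q j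

/-- The inverse of `p` for the operation `⊙`. -/
def simplexInv {n : ℕ} (p : Fin n → ℝ) : Fin n → ℝ :=
  fun i => (1 / p i) / ∑ j, 1 / p j

/-- The cost function. -/
def cost {n : ℕ} (p q : Fin n → ℝ) : ℝ :=
  Real.log ((1 / (n : ℝ)) * ∑ i, q i / p i) - (1 / (n : ℝ)) * ∑ i, Real.log (q i / p i)

/-- `γ` is a coupling of `P` and `Q`. -/
def IsCoupling {n : ℕ} (P Q : Measure (Fin n → ℝ))
    (γ : Measure ((Fin n → ℝ) × (Fin n → ℝ))) : Prop :=
  γ.map Prod.fst = P ∧ γ.map Prod.snd = Q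

/-- The optimal transport cost, as an element of `[0, ∞]`. -/
def transportCost {n : ℕ} (P Q : Measure (Fin n → ℝ)) : ℝ≥0∞ :=
  ⨅ (γ : Measure ((Fin n → ℝ) × (Fin n → ℝ))) (_ : IsCoupling P Q γ),
    ∫⁻ z, ENNReal.ofReal (cost z.1 z.2) ∂γ

/-- `(x₁, …, xₙ₋₁) ↦ (x₁, …, xₙ₋₁, 1 - x₁ - ⋯ - xₙ₋₁)`. -/
def simplexParam (n : ℕ) (x : Fin (n - 1) → ℝ) : Fin n → ℝ :=
  fun i => if h : (i : ℕ) < n - 1 then x ⟨i, h⟩ else 1 - ∑ j, x j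

theorem measurable_simplexParam (n : ℕ) : Measurable (simplexParam n) := by
  refine measurable_pi_lambda _ fun i => ?_
  unfold simplexParam
  split_ifs with h <;> fun_prop

/-- The domain of the parameterization of the open simplex by its first `n - 1` coordinates. -/
def simplexDomain (n : ℕ) : Set (Fin (n - 1) → ℝ) :=
  {x | (∀ i, 0 < x i) ∧ ∑ i, x i < 1}

/-- The `(n-1)`-dimensional Lebesgue measure `dp₁ ⋯ dpₙ₋₁` on the open simplex, regarded as a
measure on `ℝⁿ` that is concentrated on the simplex. -/
def simplexLebesgue (n : ℕ) : Measure (Fin n → ℝ) :=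
  ((volume : Measure (Fin (n - 1) → ℝ)).restrict (simplexDomain n)).map (simplexParam n)

/-- The class `𝓛`: Borel probability measures on the open simplex (as measures on `ℝⁿ` that give
no mass to the complement of the simplex) with `∑ᵢ ∫ |log pᵢ| dP < ∞`. -/
structure ClassL {n : ℕ} (P : Measure (Fin n → ℝ)) : Prop where
  isProbabilityMeasure : IsProbabilityMeasure P
  compl_null : P (openSimplex n)ᶜ = 0
  log_moment : ∑ i, ∫⁻ p, ENNReal.ofReal |Real.log (p i)| ∂P < ⊤

/-- The class `𝓛ₐ` of the absolutely continuous members of `𝓛`. -/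
structure ClassLa {n : ℕ} (P : Measure (Fin n → ℝ)) : Prop extends ClassL P where
  absolutelyContinuous : P ≪ simplexLebesgue n

/-- `φ` is exponentially concave on the open simplex. Its values elsewhere play no role. -/
def ExpConcave {n : ℕ} (φ : (Fin n → ℝ) → ℝ) : Prop :=
  ConcaveOn ℝ (openSimplex n) fun r => Real.exp (φ r)

/-- The portfolio map generated by `φ`. The directional derivatives at a point `r` of the simplex
are tangent to the simplex, so only the values of `φ` in the simplex enter. -/
def portfolioMap {n : ℕ} (φ : (Fin n → ℝ) → ℝ) (r : Fin n → ℝ) : Fin n → ℝ :=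
  fun i => r i * (1 + lineDeriv ℝ φ r (Pi.single i 1 - r))

/-- The portfolio map at time `t`: `(1 - t) e̅ + t 𝛑(r)`, with `𝛑` generated by `φ`. -/
def portfolioMapAt {n : ℕ} (φ : (Fin n → ℝ) → ℝ) (t : ℝ) (r : Fin n → ℝ) : Fin n → ℝ :=
  (1 - t) • barycenter n + t • portfolioMap φ r

/-- The map `p ↦ p ⊙ 𝛑(p⁻¹)`, with `𝛑` generated by `φ`. -/
def transportMap {n : ℕ} (φ : (Fin n → ℝ) → ℝ) (p : Fin n → ℝ) : Fin n → ℝ :=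
  perturb p (portfolioMap φ (simplexInv p))

/-- The map at time `t`: `p ↦ p ⊙ 𝛑ₜ(p⁻¹)`. -/
def transportMapAt {n : ℕ} (φ : (Fin n → ℝ) → ℝ) (t : ℝ) (p : Fin n → ℝ) : Fin n → ℝ :=
  perturb p (portfolioMapAt φ t (simplexInv p))

/-- `φ` is an exponentially concave function that generates a solution of the transport problem
for `(P, Q)`: the map `p ↦ p ⊙ 𝛑(p⁻¹)` pushes `P` forward to `Q` and is optimal. -/
structure GeneratesOptimalTransport {n : ℕ} (φ : (Fin n → ℝ) → ℝ)
    (P Q : Measure (Fin n → ℝ)) : Prop where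
  expConcave : ExpConcave φ
  aemeasurable : AEMeasurable (transportMap φ) P
  map_eq : P.map (transportMap φ) = Q
  optimal : ∫⁻ p, ENNReal.ofReal (cost p (transportMap φ p)) ∂P = transportCost P Q

/-- `(Pₜ)` (for `0 ≤ t ≤ 1`) is a displacement interpolation from `P₀` to `P₁`: the pushforward of
`P₀` under the maps `Tₜ` that come from a generator of the optimal transport. -/
def IsDisplacementInterpolation {n : ℕ} (P₀ P₁ : Measure (Fin n → ℝ))
    (P : ℝ → Measure (Fin n → ℝ)) : Prop :=
  ∃ φ : (Fin n → ℝ) → ℝ, GeneratesOptimalTransport φ P₀ P₁ ∧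
    ∀ t ∈ Icc (0 : ℝ) 1, P t = P₀.map (transportMapAt φ t)

end

end DirichletTransport

open DirichletTransport

open scoped NNReal Topology

/-! Put `r = p⁻¹` and `w = 𝛑₁(r)`. In `T_t(p) = p ⊙ 𝛑_t(r)` the ratios `q_i / p_i` are proportional
to the weights `𝛑_t(r)_i`, and the cost ignores a common factor of these ratios. Hence `c(p, T_t p)
= -(1/n) ∑ log (1 + t x_i)` with `x = n w - 1` (`cost_transportMapAt`): a convex function of `t`
that vanishes at `0` and is strictly convex unless `x = 0`.

The maps `T_t` are optimal (`transportCost_eq`). Up to separate functions of `p` and `q`, the cost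
is `log ⟨p⁻¹, q⟩`. The portfolio `𝛑_t` is supporting for `φ_t = (1-t) (1/n) ∑ log r_i + t φ`, so
`φ_t` and its logarithmic conjugate give dual potentials that are tight along `T_t`. Thus `C(P₀,
P_t)` is the integral of the explicit function above. Smoothness on `[0, 1)` is differentiation
under the integral sign, as `x_i` is bounded and `1 + t x_i` stays away from `0`. Continuity up to
`1` is dominated convergence, the value at `1` being integrable by the logarithmic moments.
Strictness holds because `x = 0` almost everywhere would make `T_1` the identity.

Absolute continuity of `P_t` for `t < 1` comes from the barycentric part of `𝛑_t`. It makes a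
monotone gradient map strongly monotone, so `T_t` has a Lipschitz inverse on each of countably many
pieces (`IsSupported.norm_sub_le`), and preimages of null sets are null. -/

namespace DirichletTransport

/-! ### Null sets of the simplex, compared with Hausdorff measure. -/

section Param

variable {n : ℕ}

/-- The first `n - 1` coordinates. -/
def firstCoords (n : ℕ) (p : Fin n → ℝ) : Fin (n - 1) → ℝ :=
  fun i => p ⟨i, lt_of_lt_of_le i.2 (Nat.sub_le n 1)⟩

theorem sum_eq_sum_firstCoords_add (hn : 1 ≤ n) (p : Fin n → ℝ) :
    ∑ i, p i = ∑ j, firstCoords n p j + p ⟨n - 1, by omega⟩ := by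
  obtain ⟨m, rfl⟩ : ∃ m, n = m + 1 := ⟨n - 1, by omega⟩
  exact Fin.sum_univ_castSucc p

theorem firstCoords_simplexParam (x : Fin (n - 1) → ℝ) :
    firstCoords n (simplexParam n x) = x := by
  funext i
  simp [firstCoords, simplexParam]

theorem simplexParam_firstCoords (hn : 1 ≤ n) {p : Fin n → ℝ} (hp : ∑ i, p i = 1) :
    simplexParam n (firstCoords n p) = p := by
  funext i
  unfold simplexParam
  split_ifs with h
  · rfl
  · rw [sum_eq_sum_firstCoords_add hn] at hp
    have : i = ⟨n - 1, by omega⟩ := Fin.ext (by have := i.2; simp only; omega)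
    rw [this]
    linarith

theorem sum_simplexParam (hn : 1 ≤ n) (x : Fin (n - 1) → ℝ) :
    ∑ i, simplexParam n x i = 1 := by
  rw [sum_eq_sum_firstCoords_add hn, firstCoords_simplexParam]
  simp [simplexParam]

theorem mem_openSimplex_iff (hn : 2 ≤ n) {p : Fin n → ℝ} :
    p ∈ openSimplex n ↔ (∀ i, 0 < p i) ∧ ∑ i, p i = 1 := by
  refine ⟨fun h => ⟨fun i => (h.1 i).1, h.2⟩, fun h => ⟨fun i => ⟨h.1 i, ?_⟩, h.2⟩⟩
  have : Nontrivial (Fin n) := Fin.nontrivial_iff_two_le.2 hn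
  obtain ⟨j, hj⟩ := exists_ne i
  rw [← h.2]
  exact Finset.single_lt_sum hj (Finset.mem_univ i) (Finset.mem_univ j) (h.1 j)
    fun k _ _ => (h.1 k).le

theorem firstCoords_mem_simplexDomain (hn : 2 ≤ n) {p : Fin n → ℝ} (hp : p ∈ openSimplex n) :
    firstCoords n p ∈ simplexDomain n := by
  refine ⟨fun i => (hp.1 _).1, ?_⟩
  have := hp.2
  rw [sum_eq_sum_firstCoords_add (by omega)] at this
  linarith [(hp.1 ⟨n - 1, by omega⟩).1]

theorem simplexParam_mem_openSimplex (hn : 2 ≤ n) {x : Fin (n - 1) → ℝ}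
    (hx : x ∈ simplexDomain n) : simplexParam n x ∈ openSimplex n := by
  rw [mem_openSimplex_iff hn]
  refine ⟨fun i => ?_, sum_simplexParam (by omega) x⟩
  unfold simplexParam
  split_ifs with h
  · exact hx.1 _
  · linarith [hx.2]

theorem measurableSet_openSimplex (n : ℕ) : MeasurableSet (openSimplex n) := by
  have : openSimplex n = (⋂ i, {p | p i ∈ Ioo (0 : ℝ) 1}) ∩ {p | ∑ i, p i = 1} := by
    ext p; simp [openSimplex]
  rw [this]
  exact (MeasurableSet.iInter fun i => (measurable_pi_apply i) measurableSet_Ioo).inter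
    (measurableSet_eq_fun (by fun_prop) measurable_const)

theorem isOpen_simplexDomain (n : ℕ) : IsOpen (simplexDomain n) := by
  have : simplexDomain n = (⋂ i, {x | 0 < x i}) ∩ {x | ∑ i, x i < 1} := by
    ext x; simp [simplexDomain]
  rw [this]
  exact (isOpen_iInter_of_finite fun i => isOpen_lt continuous_const (continuous_apply i)).inter
    (isOpen_lt (by fun_prop) continuous_const)

theorem continuous_firstCoords (n : ℕ) : Continuous (firstCoords n) := by
  unfold firstCoords; fun_prop

theorem norm_firstCoords_le (p : Fin n → ℝ) : ‖firstCoords n p‖ ≤ ‖p‖ :=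
  (pi_norm_le_iff_of_nonneg (norm_nonneg _)).2 fun _ => norm_le_pi_norm p _

theorem abs_sum_le_card_mul_norm {ι : Type*} [Fintype ι] (x : ι → ℝ) :
    |∑ i, x i| ≤ Fintype.card ι * ‖x‖ := by
  calc |∑ i, x i| ≤ ∑ i, |x i| := Finset.abs_sum_le_sum_abs _ _
    _ ≤ ∑ _i : ι, ‖x‖ := Finset.sum_le_sum fun i _ => norm_le_pi_norm x i
    _ = Fintype.card ι * ‖x‖ := by simp

theorem lipschitzWith_simplexParam (n : ℕ) : LipschitzWith (n + 1) (simplexParam n) := by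
  refine LipschitzWith.of_dist_le_mul fun x y => ?_
  push_cast
  rw [dist_eq_norm, dist_eq_norm]
  refine (pi_norm_le_iff_of_nonneg (by positivity)).2 fun i => ?_
  simp only [Pi.sub_apply, simplexParam]
  have h0 := norm_nonneg (x - y)
  split_ifs with h
  · have := norm_le_pi_norm (x - y) ⟨i, h⟩
    simp only [Pi.sub_apply] at this
    nlinarith [Nat.cast_nonneg (α := ℝ) n]
  · have := abs_sum_le_card_mul_norm (x - y)
    simp only [Pi.sub_apply, Finset.sum_sub_distrib, Fintype.card_fin] at this
    have hc : ((n - 1 : ℕ) : ℝ) ≤ n + 1 := by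
      have : n - 1 ≤ n + 1 := by omega
      exact_mod_cast this
    rw [Real.norm_eq_abs, show 1 - ∑ j, x j - (1 - ∑ j, y j) = -(∑ j, x j - ∑ j, y j) by ring,
      abs_neg]
    exact this.trans (mul_le_mul_of_nonneg_right hc h0)

theorem antilipschitzWith_simplexParam (n : ℕ) : AntilipschitzWith 1 (simplexParam n) := by
  refine AntilipschitzWith.of_le_mul_dist fun x y => ?_
  have := norm_firstCoords_le (simplexParam n x - simplexParam n y)
  have h : firstCoords n (simplexParam n x - simplexParam n y) = x - y := by
    conv_rhs => rw [← firstCoords_simplexParam x, ← firstCoords_simplexParam y]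
    rfl
  rw [h] at this
  simpa [dist_eq_norm] using this

theorem measurableEmbedding_simplexParam (n : ℕ) : MeasurableEmbedding (simplexParam n) :=
  ((antilipschitzWith_simplexParam n).isClosedEmbedding
    (lipschitzWith_simplexParam n).uniformContinuous).measurableEmbedding

theorem simplexLebesgue_apply (S : Set (Fin n → ℝ)) :
    simplexLebesgue n S = volume (simplexParam n ⁻¹' S ∩ simplexDomain n) := by
  unfold simplexLebesgue
  rw [(measurableEmbedding_simplexParam n).map_apply,
    Measure.restrict_apply' (isOpen_simplexDomain n).measurableSet]

theorem image_simplexParam (hn : 2 ≤ n) {S : Set (Fin n → ℝ)} (hS : S ⊆ openSimplex n) :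
    simplexParam n '' (simplexParam n ⁻¹' S ∩ simplexDomain n) = S := by
  ext p
  constructor
  · rintro ⟨x, hx, rfl⟩; exact hx.1
  · intro hp
    have h := simplexParam_firstCoords (by omega) (hS hp).2
    exact ⟨firstCoords n p, ⟨by simpa [h] using hp, firstCoords_mem_simplexDomain hn (hS hp)⟩, h⟩

theorem volume_eq_hausdorffMeasure (n : ℕ) :
    (volume : Measure (Fin (n - 1) → ℝ)) = Measure.hausdorffMeasure ((n - 1 : ℕ) : ℝ) := by
  rw [← hausdorffMeasure_pi_real, Fintype.card_fin]

/-- The parameterization is bi-Lipschitz, so it preserves nullity for `(n-1)`-dimensional Hausdorff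
measure. Null sets can then be moved by Lipschitz estimates alone, with no change of variables
formula. -/
theorem simplexLebesgue_eq_zero_iff (hn : 2 ≤ n) {S : Set (Fin n → ℝ)} (hS : S ⊆ openSimplex n) :
    simplexLebesgue n S = 0 ↔ Measure.hausdorffMeasure ((n - 1 : ℕ) : ℝ) S = 0 := by
  rw [simplexLebesgue_apply, volume_eq_hausdorffMeasure]
  constructor <;> intro h
  · rw [← image_simplexParam hn hS, ← nonpos_iff_eq_zero]
    refine ((lipschitzWith_simplexParam n).hausdorffMeasure_image_le (Nat.cast_nonneg _) _).trans ?_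
    rw [h, mul_zero]
  · rw [← nonpos_iff_eq_zero]
    refine ((antilipschitzWith_simplexParam n).le_hausdorffMeasure_image
      (Nat.cast_nonneg _) _).trans ?_
    rw [image_simplexParam hn hS, h, mul_zero]

/-- A set is null if it has a null image under a map that is bounded below on it. -/
theorem simplexLebesgue_eq_zero_of_antilipschitz (hn : 2 ≤ n) {S N : Set (Fin n → ℝ)}
    (hS : S ⊆ openSimplex n) {F : (Fin n → ℝ) → (Fin n → ℝ)} {K : ℝ}
    (hF : ∀ x ∈ S, ∀ y ∈ S, ‖x - y‖ ≤ K * ‖F x - F y‖) (hFN : ∀ x ∈ S, F x ∈ N)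
    (hFS : ∀ x ∈ S, F x ∈ openSimplex n)
    (hN : simplexLebesgue n N = 0) : simplexLebesgue n S = 0 := by
  have h1 : simplexLebesgue n (F '' S) = 0 :=
    measure_mono_null (by rintro _ ⟨x, hx, rfl⟩; exact hFN x hx) hN
  rw [simplexLebesgue_eq_zero_iff hn (by rintro _ ⟨x, hx, rfl⟩; exact hFS x hx)] at h1
  rw [simplexLebesgue_eq_zero_iff hn hS]
  have ha : AntilipschitzWith K.toNNReal (fun x : S => F x) := by
    refine AntilipschitzWith.of_le_mul_dist fun x y => ?_
    rw [Subtype.dist_eq, dist_eq_norm, dist_eq_norm]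
    exact (hF x x.2 y y.2).trans
      (mul_le_mul_of_nonneg_right (Real.le_coe_toNNReal K) (norm_nonneg _))
  have h2 := ha.le_hausdorffMeasure_image (Nat.cast_nonneg (n - 1)) univ
  have h3 : (fun x : S => F x) '' univ = F '' S := by
    ext y; simp
  rw [h3, h1, mul_zero, nonpos_iff_eq_zero] at h2
  have h4 := (isometry_subtype_coe (s := S)).hausdorffMeasure_image
    (Or.inl (Nat.cast_nonneg (n - 1))) univ
  rw [image_univ, Subtype.range_coe] at h4
  rw [h4, h2]

end Param

/-! ### Exponentially concave functions: differentiability almost everywhere and supergradients. -/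

section ExpConcave

variable {n : ℕ} {φ : (Fin n → ℝ) → ℝ}

theorem simplexParam_combo (n : ℕ) (x y : Fin (n - 1) → ℝ) {a b : ℝ} (hab : a + b = 1) :
    simplexParam n (a • x + b • y) = a • simplexParam n x + b • simplexParam n y := by
  funext i
  simp only [simplexParam, Pi.add_apply, Pi.smul_apply, smul_eq_mul]
  split_ifs with h
  · rfl
  · rw [Finset.sum_add_distrib, ← Finset.mul_sum, ← Finset.mul_sum]
    linear_combination (-1 : ℝ) * hab

theorem convex_simplexDomain (n : ℕ) : Convex ℝ (simplexDomain n) := by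
  intro x hx y hy a b ha hb hab
  refine ⟨fun i => ?_, ?_⟩
  · simp only [Pi.add_apply, Pi.smul_apply, smul_eq_mul]
    rcases ha.eq_or_lt with rfl | ha
    · simp only [zero_add] at hab; subst hab; simpa using hy.1 i
    · have := mul_pos ha (hx.1 i)
      have := mul_nonneg hb (hy.1 i).le
      linarith
  · simp only [Pi.add_apply, Pi.smul_apply, smul_eq_mul, Finset.sum_add_distrib,
      ← Finset.mul_sum]
    have := convex_Iio (𝕜 := ℝ) (1 : ℝ) hx.2 hy.2 ha hb hab
    simpa using this

theorem ExpConcave.concaveOn_comp_simplexParam (hn : 2 ≤ n) (hφ : ExpConcave φ) :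
    ConcaveOn ℝ (simplexDomain n) fun x => Real.exp (φ (simplexParam n x)) := by
  refine ⟨convex_simplexDomain n, fun x hx y hy a b ha hb hab => ?_⟩
  have := hφ.2 (simplexParam_mem_openSimplex hn hx) (simplexParam_mem_openSimplex hn hy) ha hb hab
  rw [← simplexParam_combo n x y hab] at this
  exact this

theorem ExpConcave.continuousOn (hn : 2 ≤ n) (hφ : ExpConcave φ) :
    ContinuousOn φ (openSimplex n) := by
  have h1 : ContinuousOn (fun x => Real.exp (φ (simplexParam n x))) (simplexDomain n) :=
    (hφ.concaveOn_comp_simplexParam hn).continuousOn (isOpen_simplexDomain n)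
  have h2 : ContinuousOn (fun x => φ (simplexParam n x)) (simplexDomain n) := by
    have := h1.log fun x _ => (Real.exp_pos _).ne'
    simpa using this
  refine (h2.comp (continuous_firstCoords n).continuousOn
    fun p hp => firstCoords_mem_simplexDomain hn hp).congr fun p hp => ?_
  simp [simplexParam_firstCoords (by omega) hp.2]

/-- `φ` has a linear derivative at `r` along the simplex. -/
def TangentDifferentiableAt (φ : (Fin n → ℝ) → ℝ) (r : Fin n → ℝ) : Prop :=
  ∃ L : (Fin n → ℝ) →ₗ[ℝ] ℝ, ∀ v, ∑ i, v i = 0 → HasLineDerivAt ℝ φ (L v) r v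

/-- The first `n - 1` coordinates, as a linear map. -/
def firstCoordsLinear (n : ℕ) : (Fin n → ℝ) →ₗ[ℝ] (Fin (n - 1) → ℝ) where
  toFun := firstCoords n
  map_add' _ _ := rfl
  map_smul' _ _ := rfl

theorem tangentDifferentiableAt_of_differentiableAt (hn : 1 ≤ n) {r : Fin n → ℝ}
    (hr : ∑ i, r i = 1)
    (h : DifferentiableAt ℝ (fun x => φ (simplexParam n x)) (firstCoords n r)) :
    TangentDifferentiableAt φ r := by
  refine ⟨(fderiv ℝ (fun x => φ (simplexParam n x)) (firstCoords n r)).toLinearMap ∘ₗ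
    firstCoordsLinear n, fun v hv => ?_⟩
  have h1 := h.hasFDerivAt.hasLineDerivAt (firstCoords n v)
  unfold HasLineDerivAt at h1 ⊢
  refine h1.congr_of_eventuallyEq (Filter.Eventually.of_forall fun t => ?_)
  have : firstCoords n r + t • firstCoords n v = firstCoords n (r + t • v) := rfl
  simp only [this]
  rw [simplexParam_firstCoords hn]
  simp [Finset.sum_add_distrib, ← Finset.mul_sum, hr, hv]

/-- A concave function on an open set is locally Lipschitz, so Rademacher's theorem applies near
each point. -/
theorem ExpConcave.simplexLebesgue_not_tangentDifferentiableAt (hn : 2 ≤ n) (hφ : ExpConcave φ) :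
    simplexLebesgue n {r | r ∈ openSimplex n ∧ ¬ TangentDifferentiableAt φ r} = 0 := by
  set f := fun x => Real.exp (φ (simplexParam n x)) with hf
  have hU := isOpen_simplexDomain n
  have hL := (hφ.concaveOn_comp_simplexParam hn).locallyLipschitzOn hU
  rw [simplexLebesgue_apply]
  have hnull : volume {x | x ∈ simplexDomain n ∧ ¬ DifferentiableAt ℝ f x} = 0 := by
    refine measure_null_of_locally_null _ fun x hx => ?_
    obtain ⟨K, s, hs, hK⟩ := hL hx.1
    have hs' : s ∈ 𝓝 x := by
      rwa [nhdsWithin_eq_nhds.2 (hU.mem_nhds hx.1)] at hs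
    have hK' := hK.mono (interior_subset (s := s))
    have hae := hK'.ae_differentiableWithinAt_of_mem (μ := volume)
    refine ⟨interior s ∩ {x | x ∈ simplexDomain n ∧ ¬ DifferentiableAt ℝ f x},
      Filter.inter_mem (mem_nhdsWithin_of_mem_nhds (interior_mem_nhds.2 hs'))
        self_mem_nhdsWithin, measure_mono_null ?_ hae⟩
    rintro y ⟨hy, hy'⟩ hc
    exact hy'.2 ((hc hy).differentiableAt (isOpen_interior.mem_nhds hy))
  refine measure_mono_null ?_ hnull
  rintro x ⟨⟨-, hx⟩, hxU⟩
  refine ⟨hxU, fun hd => hx ?_⟩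
  refine tangentDifferentiableAt_of_differentiableAt (by omega) (sum_simplexParam (by omega) x) ?_
  rw [firstCoords_simplexParam]
  have := hd.log (Real.exp_pos _).ne'
  simpa [hf] using this

/-- The portfolio generated at `r` gives a supergradient of `exp φ` at `r`. -/
structure IsSupported (φ : (Fin n → ℝ) → ℝ) (r : Fin n → ℝ) : Prop where
  sum_eq_one : ∑ i, portfolioMap φ r i = 1
  nonneg : ∀ i, 0 ≤ portfolioMap φ r i
  le : ∀ s ∈ openSimplex n,
    Real.exp (φ s - φ r) ≤ ∑ i, portfolioMap φ r i / r i * s i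

theorem ExpConcave.isSupported (hn : 2 ≤ n) (hφ : ExpConcave φ) {r : Fin n → ℝ}
    (hr : r ∈ openSimplex n) (hd : TangentDifferentiableAt φ r) : IsSupported φ r := by
  obtain ⟨L, hL⟩ := hd
  have hsing (i : Fin n) : ∑ j, (Pi.single i (1 : ℝ) - r : Fin n → ℝ) j = 0 := by
    simp [Finset.sum_sub_distrib, hr.2]
  have hw (i : Fin n) : portfolioMap φ r i = r i * (1 + L (Pi.single i 1 - r)) := by
    rw [portfolioMap, (hL _ (hsing i)).lineDeriv]
  -- The directions `e_i - r` combine with weights `s_i` to `s - r`; so the portfolio ratios encode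
  -- the affine tangent function of `exp (φ - φ r)` at `r`.
  have hlin (s : Fin n → ℝ) (hs : ∑ i, s i = 1) :
      ∑ i, s i * L (Pi.single i 1 - r) = L (s - r) := by
    have h1 : s - r = ∑ i, s i • (Pi.single i 1 - r : Fin n → ℝ) := by
      simp only [smul_sub, Finset.sum_sub_distrib, ← Finset.sum_smul, hs, one_smul]
      congr 1
      funext j
      simp [Finset.sum_apply, Pi.single_apply]
    rw [h1, map_sum]
    simp
  have hdiv (i : Fin n) : portfolioMap φ r i / r i = 1 + L (Pi.single i 1 - r) := by
    rw [hw, mul_div_cancel_left₀ _ (hr.1 i).1.ne']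
  have hsum (s : Fin n → ℝ) (hs : ∑ i, s i = 1) :
      ∑ i, portfolioMap φ r i / r i * s i = 1 + L (s - r) := by
    rw [← hlin s hs]
    simp only [hdiv, add_mul, one_mul, Finset.sum_add_distrib, hs]
    exact congrArg _ (Finset.sum_congr rfl fun i _ => mul_comm _ _)
  have hle : ∀ s ∈ openSimplex n,
      Real.exp (φ s - φ r) ≤ ∑ i, portfolioMap φ r i / r i * s i := by
    intro s hs
    rw [hsum s hs.2]
    have hv : ∑ i, (s - r) i = 0 := by simp [Finset.sum_sub_distrib, hs.2, hr.2]
    have h1 := (hL _ hv)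
    have h2 : HasDerivAt (fun t : ℝ => Real.exp (φ (r + t • (s - r))))
        (Real.exp (φ r) * L (s - r)) 0 := by
      have := HasDerivAt.exp h1
      simpa using this
    have h3 : ConcaveOn ℝ (Icc (0 : ℝ) 1) fun t : ℝ => Real.exp (φ (r + t • (s - r))) := by
      have := hφ.comp_affineMap (AffineMap.lineMap (k := ℝ) r s)
      have hsub : Icc (0 : ℝ) 1 ⊆ AffineMap.lineMap (k := ℝ) r s ⁻¹' openSimplex n :=
        fun t ht => hφ.1.lineMap_mem hr hs ht
      refine (this.subset hsub (convex_Icc 0 1)).congr ?_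
      · intro t ht
        simp [AffineMap.lineMap_apply, add_comm]
    have h4 := h3.slope_le_of_hasDerivAt (left_mem_Icc.2 zero_le_one)
      (right_mem_Icc.2 zero_le_one) zero_lt_one h2
    simp only [slope_def_field, zero_smul, add_zero, one_smul, sub_zero, div_one,
      add_sub_cancel] at h4
    rw [Real.exp_sub, div_le_iff₀ (Real.exp_pos _)]
    linarith
  refine ⟨?_, fun i => ?_, hle⟩
  · have := hsum r hr.2
    rw [sub_self, map_zero, add_zero] at this
    rw [← this]
    exact Finset.sum_congr rfl fun i _ => (div_mul_cancel₀ _ (hr.1 i).1.ne').symm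
  · rw [hw]
    refine mul_nonneg (hr.1 i).1.le ?_
    by_contra! hneg
    -- A negative weight would make the affine majorant negative at the vertex `e_i`, hence at
    -- simplex points near it, where it must dominate an exponential.
    have hcont : Continuous fun t : ℝ => 1 + (1 - t) * L (Pi.single i 1 - r) := by fun_prop
    have hmem : ∀ᶠ t in 𝓝[>] (0 : ℝ), 1 + (1 - t) * L (Pi.single i 1 - r) < 0 := by
      refine nhdsWithin_le_nhds ((hcont.tendsto 0).eventually_lt_const ?_)
      simpa using hneg
    obtain ⟨t, ht, ht0, ht1⟩ := (hmem.and (Ioo_mem_nhdsGT (zero_lt_one' ℝ))).exists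
    have hs : (t • r + (1 - t) • Pi.single i 1 : Fin n → ℝ) ∈ openSimplex n := by
      rw [mem_openSimplex_iff hn]
      refine ⟨fun j => ?_, ?_⟩
      · have h1 := mul_pos ht0 (hr.1 j).1
        have h2 : 0 ≤ (1 - t) * (Pi.single i 1 : Fin n → ℝ) j := by
          refine mul_nonneg (by linarith) ?_
          rw [Pi.single_apply]; split_ifs <;> norm_num
        simp only [Pi.add_apply, Pi.smul_apply, smul_eq_mul]
        linarith
      · simp [Finset.sum_add_distrib, ← Finset.mul_sum, hr.2]
    have h5 := hle _ hs
    rw [hsum _ hs.2] at h5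
    have h6 : t • r + (1 - t) • Pi.single i 1 - r
        = (1 - t) • (Pi.single i 1 - r : Fin n → ℝ) := by
      rw [smul_sub, sub_smul, sub_smul, one_smul, one_smul]; abel
    rw [h6, map_smul, smul_eq_mul] at h5
    linarith [Real.exp_pos (φ (t • r + (1 - t) • Pi.single i 1) - φ r)]

end ExpConcave

/-! ### The inversion of the simplex and almost everywhere support. -/

section Inverse

variable {n : ℕ}

theorem one_le_inv_of_mem {p : Fin n → ℝ} (hp : p ∈ openSimplex n) (i : Fin n) : 1 ≤ 1 / p i :=
  (one_le_div (hp.1 i).1).2 (hp.1 i).2.le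

theorem one_le_sum_inv {p : Fin n → ℝ} (hn : 1 ≤ n) (hp : p ∈ openSimplex n) :
    1 ≤ ∑ j, 1 / p j :=
  (one_le_inv_of_mem hp ⟨0, hn⟩).trans (Finset.single_le_sum
    (fun j _ => zero_le_one.trans (one_le_inv_of_mem hp j)) (Finset.mem_univ _))

theorem simplexInv_mem (hn : 2 ≤ n) {p : Fin n → ℝ} (hp : p ∈ openSimplex n) :
    simplexInv p ∈ openSimplex n := by
  have hS := one_le_sum_inv (by omega) hp
  rw [mem_openSimplex_iff hn]
  refine ⟨fun i => div_pos (zero_lt_one.trans_le (one_le_inv_of_mem hp i)) (by linarith), ?_⟩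
  simp only [simplexInv]
  rw [← Finset.sum_div, div_self (by linarith)]

theorem one_div_simplexInv {p : Fin n → ℝ} (i : Fin n) :
    1 / simplexInv p i = p i * ∑ j, 1 / p j := by
  simp [simplexInv, div_eq_mul_inv, mul_comm]

theorem simplexInv_simplexInv (hn : 2 ≤ n) {p : Fin n → ℝ} (hp : p ∈ openSimplex n) :
    simplexInv (simplexInv p) = p := by
  have hS := one_le_sum_inv (by omega) hp
  funext i
  rw [simplexInv]
  simp only [one_div_simplexInv]
  rw [← Finset.sum_mul, hp.2, one_mul, mul_div_cancel_right₀ _ (by linarith)]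

/-- Normalization to sum `1` is Lipschitz away from the origin. -/
theorem norm_normalize_sub_le {x y : Fin n → ℝ} {a b : ℝ} (hx : ∑ i, x i = a)
    (hy : ∑ i, y i = b) (ha : 1 ≤ a) (hb : 1 ≤ b) (hy0 : ∀ i, 0 ≤ y i) :
    ‖(fun i => x i / a) - (fun i => y i / b)‖ ≤ (1 + n) * ‖x - y‖ := by
  have h0 := norm_nonneg (x - y)
  refine (pi_norm_le_iff_of_nonneg (by positivity)).2 fun i => ?_
  simp only [Pi.sub_apply, Real.norm_eq_abs]
  have hyi : y i / b ≤ 1 := by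
    rw [div_le_one (by linarith), ← hy]
    exact Finset.single_le_sum (fun j _ => hy0 j) (Finset.mem_univ i)
  have hyi0 : 0 ≤ y i / b := div_nonneg (hy0 i) (by linarith)
  have hab : |b - a| ≤ n * ‖x - y‖ := by
    have := abs_sum_le_card_mul_norm (x - y)
    simp only [Pi.sub_apply, Finset.sum_sub_distrib, Fintype.card_fin, hx, hy] at this
    rwa [abs_sub_comm]
  have hxy : |x i - y i| ≤ ‖x - y‖ := norm_le_pi_norm (x - y) i
  have key : x i / a - y i / b = ((x i - y i) + (b - a) * (y i / b)) / a := by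
    have : a ≠ 0 := by linarith
    have : b ≠ 0 := by linarith
    field_simp
    ring
  rw [key, abs_div, abs_of_pos (show 0 < a by linarith), div_le_iff₀ (by linarith)]
  calc |x i - y i + (b - a) * (y i / b)| ≤ |x i - y i| + |(b - a) * (y i / b)| := abs_add_le _ _
    _ ≤ ‖x - y‖ + n * ‖x - y‖ := by
        refine add_le_add hxy ?_
        rw [abs_mul, abs_of_nonneg hyi0]
        calc |b - a| * (y i / b) ≤ |b - a| * 1 := mul_le_mul_of_nonneg_left hyi (abs_nonneg _)
          _ ≤ n * ‖x - y‖ := by rwa [mul_one]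
    _ = (1 + n) * ‖x - y‖ * 1 := by ring
    _ ≤ (1 + n) * ‖x - y‖ * a := mul_le_mul_of_nonneg_left ha (by positivity)

theorem norm_simplexInv_sub_le (hn : 2 ≤ n) {p q : Fin n → ℝ} (hp : p ∈ openSimplex n)
    (hq : q ∈ openSimplex n) {M : ℝ} (hpM : ∀ i, 1 / p i ≤ M) (hqM : ∀ i, 1 / q i ≤ M) :
    ‖simplexInv p - simplexInv q‖ ≤ (1 + n) * M ^ 2 * ‖p - q‖ := by
  have h1 : ‖simplexInv p - simplexInv q‖
      ≤ (1 + n) * ‖(fun i => 1 / p i) - (fun i => 1 / q i)‖ :=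
    norm_normalize_sub_le (x := fun i => 1 / p i) (y := fun i => 1 / q i) rfl rfl
      (one_le_sum_inv (by omega) hp) (one_le_sum_inv (by omega) hq)
      fun i => zero_le_one.trans (one_le_inv_of_mem hq i)
  refine h1.trans ?_
  rw [mul_assoc]
  refine mul_le_mul_of_nonneg_left ?_ (by positivity)
  refine (pi_norm_le_iff_of_nonneg (by positivity)).2 fun i => ?_
  have hpi := (hp.1 i).1
  have hqi := (hq.1 i).1
  have h2 := one_le_inv_of_mem hp i
  have h3 := one_le_inv_of_mem hq i
  have h4 : |p i - q i| ≤ ‖p - q‖ := norm_le_pi_norm (p - q) i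
  simp only [Pi.sub_apply, Real.norm_eq_abs]
  have key : 1 / p i - 1 / q i = (1 / p i * (1 / q i)) * (q i - p i) := by
    field_simp
  rw [key, abs_mul, abs_of_nonneg (by positivity), abs_sub_comm, pow_two]
  exact mul_le_mul (mul_le_mul (hpM i) (hqM i) (by linarith) (by linarith [hpM i])) h4
    (abs_nonneg _) (mul_self_nonneg M)

/-- The inversion maps null sets to null sets. -/
theorem simplexLebesgue_preimage_simplexInv (hn : 2 ≤ n) {N : Set (Fin n → ℝ)}
    (hN : simplexLebesgue n N = 0) :
    simplexLebesgue n {p | p ∈ openSimplex n ∧ simplexInv p ∈ N} = 0 := by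
  -- Inversion is an involution that is Lipschitz away from the boundary. Bounding `1 / simplexInv p
  -- i` by `M` thus makes it bounded below on each piece.
  refine measure_mono_null (t := ⋃ M : ℕ, {p | (p ∈ openSimplex n ∧ simplexInv p ∈ N) ∧
    ∀ i, 1 / simplexInv p i ≤ M}) ?_ (measure_iUnion_null fun M => ?_)
  · intro p hp
    obtain ⟨M, hM⟩ := exists_nat_ge (∑ i, 1 / simplexInv p i)
    refine mem_iUnion.2 ⟨M, hp, fun i => le_trans ?_ hM⟩
    exact Finset.single_le_sum (f := fun i => 1 / simplexInv p i)
      (fun j _ => zero_le_one.trans (one_le_inv_of_mem (simplexInv_mem hn hp.1) j))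
      (Finset.mem_univ i)
  · refine simplexLebesgue_eq_zero_of_antilipschitz hn (F := simplexInv)
      (K := (1 + n) * (M : ℝ) ^ 2) (fun p hp => hp.1.1) (fun p hp q hq => ?_) (fun p hp => hp.1.2)
      (fun p hp => simplexInv_mem hn hp.1.1) hN
    have := norm_simplexInv_sub_le hn (simplexInv_mem hn hp.1.1) (simplexInv_mem hn hq.1.1)
      hp.2 hq.2
    rwa [simplexInv_simplexInv hn hp.1.1, simplexInv_simplexInv hn hq.1.1] at this

theorem ClassL.ae_mem {P : Measure (Fin n → ℝ)} (h : ClassL P) : ∀ᵐ p ∂P, p ∈ openSimplex n := by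
  rw [ae_iff]; exact h.compl_null

theorem ExpConcave.ae_isSupported (hn : 2 ≤ n) {φ : (Fin n → ℝ) → ℝ} (hφ : ExpConcave φ)
    {P : Measure (Fin n → ℝ)} (h : ClassLa P) : ∀ᵐ p ∂P, IsSupported φ (simplexInv p) := by
  have h1 := h.absolutelyContinuous (simplexLebesgue_preimage_simplexInv hn
    (hφ.simplexLebesgue_not_tangentDifferentiableAt hn))
  have h2 := (measure_eq_zero_iff_ae_notMem).1 h1
  filter_upwards [h2, h.toClassL.ae_mem] with p hp hpS
  by_contra hc
  exact hp ⟨hpS, simplexInv_mem hn hpS, fun hd =>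
    hc (hφ.isSupported hn (simplexInv_mem hn hpS) hd)⟩

end Inverse

/-! ### Smooth dependence on `t` of `∫ log (1 + t u)`. -/

section ParametricIntegral

variable {Ω : Type*} [MeasurableSpace Ω] {μ : Measure Ω} [IsProbabilityMeasure μ]

/-- Differentiation under the integral sign for a function of a random variable with values in a
compact interval. -/
theorem hasDerivAt_integral_comp_of_compact {u : Ω → ℝ} (hu : AEMeasurable u μ) {c d a b t₀ : ℝ}
    (hcd : ∀ᵐ ω ∂μ, u ω ∈ Icc c d) (ht₀ : t₀ ∈ Ioo a b) {f f' : ℝ → ℝ → ℝ}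
    (hf : ∀ t, Measurable (f t)) (hf' : ∀ t, Measurable (f' t))
    (hfc : ContinuousOn (f t₀) (Icc c d))
    (hfc' : ContinuousOn (fun z : ℝ × ℝ => f' z.1 z.2) (Icc a b ×ˢ Icc c d))
    (hd : ∀ t ∈ Icc a b, ∀ x ∈ Icc c d, HasDerivAt (fun t => f t x) (f' t x) t) :
    HasDerivAt (fun t => ∫ ω, f t (u ω) ∂μ) (∫ ω, f' t₀ (u ω) ∂μ) t₀ := by
  obtain ⟨C, hC⟩ := (isCompact_Icc (a := c) (b := d)).exists_bound_of_continuousOn hfc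
  obtain ⟨C', hC'⟩ := ((isCompact_Icc (a := a) (b := b)).prod
    (isCompact_Icc (a := c) (b := d))).exists_bound_of_continuousOn hfc'
  have hint : Integrable (fun ω => f t₀ (u ω)) μ :=
    Integrable.of_bound ((hf t₀).comp_aemeasurable hu).aestronglyMeasurable C
      (hcd.mono fun ω hω => hC _ hω)
  refine (hasDerivAt_integral_of_dominated_loc_of_deriv_le (bound := fun _ => C')
    (Ioo_mem_nhds ht₀.1 ht₀.2)
    (Filter.Eventually.of_forall fun t => ((hf t).comp_aemeasurable hu).aestronglyMeasurable)
    hint (F' := fun t ω => f' t (u ω))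
    ((hf' t₀).comp_aemeasurable hu).aestronglyMeasurable ?_ (integrable_const _) ?_).2
  · exact hcd.mono fun ω hω t ht => hC' (t, u ω) ⟨Ioo_subset_Icc_self ht, hω⟩
  · exact hcd.mono fun ω hω t ht => hd t (Ioo_subset_Icc_self ht) _ hω

/-- The interval reaches below `0`, so that smoothness on `[0, 1)`, with one-sided derivatives at
`0`, is inherited from an open interval. -/
theorem one_add_mul_pos {B t x : ℝ} (hB : 0 < B) (ht : t ∈ Ioo (-(1 / B)) 1)
    (hx : x ∈ Icc (-1) B) : 0 < 1 + t * x := by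
  rcases le_total 0 t with h | h
  · nlinarith [hx.1, ht.2]
  · have h1 : -1 < t * B := by
      have := mul_lt_mul_of_pos_right ht.1 hB
      rwa [neg_mul, one_div_mul_cancel hB.ne'] at this
    nlinarith [hx.2, ht.1]

variable {u : Ω → ℝ} {B : ℝ}

theorem hasDerivAt_integral_comp_of_Ioo (hu : AEMeasurable u μ)
    (hcd : ∀ᵐ ω ∂μ, u ω ∈ Icc (-1) B) {t₀ : ℝ} (ht₀ : t₀ ∈ Ioo (-(1 / B)) 1)
    {f f' : ℝ → ℝ → ℝ} (hf : ∀ t, Measurable (f t)) (hf' : ∀ t, Measurable (f' t))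
    (hfc : ContinuousOn (f t₀) (Icc (-1) B))
    (hfc' : ContinuousOn (fun z : ℝ × ℝ => f' z.1 z.2) (Ioo (-(1 / B)) 1 ×ˢ Icc (-1) B))
    (hd : ∀ t ∈ Ioo (-(1 / B)) 1, ∀ x ∈ Icc (-1) B, HasDerivAt (fun t => f t x) (f' t x) t) :
    HasDerivAt (fun t => ∫ ω, f t (u ω) ∂μ) (∫ ω, f' t₀ (u ω) ∂μ) t₀ := by
  obtain ⟨a, ha1, ha2⟩ := exists_between ht₀.1
  obtain ⟨b, hb1, hb2⟩ := exists_between ht₀.2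
  have hsub : Icc a b ⊆ Ioo (-(1 / B)) 1 := fun t ht => ⟨ha1.trans_le ht.1, ht.2.trans_lt hb2⟩
  exact hasDerivAt_integral_comp_of_compact hu hcd ⟨ha2, hb1⟩ hf hf' hfc
    (hfc'.mono (prod_mono_left hsub)) fun t ht => hd t (hsub ht)

/-- Up to constants, the powers of `u / (1 + t u)` are closed under differentiation in `t`; the
first power is the derivative of `log (1 + t u)`. This drives the induction for all orders. -/
theorem hasDerivAt_integral_div_pow (hB : 0 < B) (hu : AEMeasurable u μ)
    (hcd : ∀ᵐ ω ∂μ, u ω ∈ Icc (-1) B) (k : ℕ) {t₀ : ℝ} (ht₀ : t₀ ∈ Ioo (-(1 / B)) 1) :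
    HasDerivAt (fun t => ∫ ω, (u ω / (1 + t * u ω)) ^ (k + 1) ∂μ)
      (-(k + 1) * ∫ ω, (u ω / (1 + t₀ * u ω)) ^ (k + 2) ∂μ) t₀ := by
  rw [← integral_const_mul]
  refine hasDerivAt_integral_comp_of_Ioo (f := fun t x => (x / (1 + t * x)) ^ (k + 1))
    (f' := fun t x => -(k + 1) * (x / (1 + t * x)) ^ (k + 2)) hu hcd ht₀
    (fun t => by fun_prop) (fun t => by fun_prop) ?_ ?_ fun t ht x hx => ?_
  · refine (ContinuousOn.div (by fun_prop) (by fun_prop) fun x hx => ?_).pow _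
    exact (one_add_mul_pos hB ht₀ hx).ne'
  · refine ContinuousOn.mul (by fun_prop)
      ((ContinuousOn.div (by fun_prop) (by fun_prop) fun z hz => ?_).pow _)
    exact (one_add_mul_pos hB hz.1 hz.2).ne'
  · have h0 := (one_add_mul_pos hB ht hx).ne'
    have h1 : HasDerivAt (fun t : ℝ => 1 + t * x) x t := by
      simpa using ((hasDerivAt_id t).mul_const x).const_add 1
    have h2 := (((hasDerivAt_const t x).div h1 h0).pow (k + 1))
    refine h2.congr_deriv ?_
    simp only [Nat.add_sub_cancel, Pi.div_apply]
    push_cast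
    rw [pow_add (x / (1 + t * x)) k 2]
    field_simp
    ring

theorem contDiffOn_integral_div_pow (hB : 0 < B) (hu : AEMeasurable u μ)
    (hcd : ∀ᵐ ω ∂μ, u ω ∈ Icc (-1) B) (m k : ℕ) :
    ContDiffOn ℝ m (fun t => ∫ ω, (u ω / (1 + t * u ω)) ^ (k + 1) ∂μ) (Ioo (-(1 / B)) 1) := by
  induction m generalizing k with
  | zero =>
    refine contDiffOn_zero.2 fun t ht => ?_
    exact (hasDerivAt_integral_div_pow hB hu hcd k ht).continuousAt.continuousWithinAt
  | succ m ih =>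
    push_cast
    refine (contDiffOn_succ_iff_deriv_of_isOpen isOpen_Ioo).2 ⟨fun t ht =>
      (hasDerivAt_integral_div_pow hB hu hcd k ht).differentiableAt.differentiableWithinAt,
      by simp, ?_⟩
    refine (contDiffOn_const.mul (ih (k + 1))).congr fun t ht =>
      (hasDerivAt_integral_div_pow hB hu hcd k ht).deriv

theorem contDiffOn_integral_log (hB : 0 < B) (hu : AEMeasurable u μ)
    (hcd : ∀ᵐ ω ∂μ, u ω ∈ Icc (-1) B) :
    ContDiffOn ℝ (⊤ : ℕ∞) (fun t => ∫ ω, Real.log (1 + t * u ω) ∂μ) (Ioo (-(1 / B)) 1) := by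
  have hderiv : ∀ t ∈ Ioo (-(1 / B)) 1, HasDerivAt (fun t => ∫ ω, Real.log (1 + t * u ω) ∂μ)
      (∫ ω, (u ω / (1 + t * u ω)) ^ (0 + 1) ∂μ) t := by
    intro t₀ ht₀
    refine hasDerivAt_integral_comp_of_Ioo (f := fun t x => Real.log (1 + t * x))
      (f' := fun t x => (x / (1 + t * x)) ^ (0 + 1)) hu hcd ht₀
      (fun t => by fun_prop) (fun t => by fun_prop) ?_ ?_ fun t ht x hx => ?_
    · refine ContinuousOn.log (by fun_prop) fun x hx => ?_
      exact (one_add_mul_pos hB ht₀ hx).ne'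
    · refine (ContinuousOn.div (by fun_prop) (by fun_prop) fun z hz => ?_).pow _
      exact (one_add_mul_pos hB hz.1 hz.2).ne'
    · have h1 : HasDerivAt (fun t : ℝ => 1 + t * x) x t := by
        simpa using ((hasDerivAt_id t).mul_const x).const_add 1
      simpa using h1.log (one_add_mul_pos hB ht hx).ne'
  refine contDiffOn_infty.2 fun m => ?_
  refine ContDiffOn.of_le (n := ((m : WithTop ℕ∞) + 1)) ?_ le_self_add
  refine (contDiffOn_succ_iff_deriv_of_isOpen isOpen_Ioo).2 ⟨fun t ht =>
    (hderiv t ht).differentiableAt.differentiableWithinAt, by simp, ?_⟩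
  exact (contDiffOn_integral_div_pow hB hu hcd m 0).congr fun t ht => (hderiv t ht).deriv

theorem integrable_log_one_add_mul (hu : AEMeasurable u μ) (hB : 0 < B)
    (hcd : ∀ᵐ ω ∂μ, u ω ∈ Icc (-1) B) {t : ℝ} (ht : t ∈ Ico 0 1) :
    Integrable (fun ω => Real.log (1 + t * u ω)) μ := by
  have ht' : t ∈ Ioo (-(1 / B)) 1 := ⟨(neg_neg_of_pos (by positivity)).trans_le ht.1, ht.2⟩
  obtain ⟨C, hC⟩ := (isCompact_Icc (a := (-1 : ℝ)) (b := B)).exists_bound_of_continuousOn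
    (f := fun x => Real.log (1 + t * x))
    (ContinuousOn.log (by fun_prop) fun x hx => (one_add_mul_pos hB ht' hx).ne')
  exact Integrable.of_bound (AEMeasurable.aestronglyMeasurable (by fun_prop)) C
    (hcd.mono fun ω hω => hC _ hω)

end ParametricIntegral

/-! ### The explicit cost along the interpolation: convexity, domination, integration. -/

section Entropy

variable {n : ℕ}

/-- The entropy of the uniform distribution relative to the distribution with weights
`(1 + t xᵢ) / n`. -/
noncomputable def entropyAlong (x : Fin n → ℝ) (t : ℝ) : ℝ :=
  -(1 / (n : ℝ)) * ∑ i, Real.log (1 + t * x i)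

/-- `(1 + xᵢ) / n` are positive weights with sum `1`. -/
structure IsRelativeWeight (x : Fin n → ℝ) : Prop where
  gt : ∀ i, -1 < x i
  sum_eq_zero : ∑ i, x i = 0

variable {x : Fin n → ℝ}

theorem IsRelativeWeight.one_add_pos (hx : IsRelativeWeight x) {t : ℝ} (ht : t ∈ Icc (0 : ℝ) 1)
    (i : Fin n) : 0 < 1 + t * x i := by
  have := hx.gt i
  rcases ht.1.eq_or_lt with rfl | h
  · simp
  · nlinarith [ht.2]

/-- The numbers `1 + x_j` are positive with sum `n`. The bound serves as `B` in the parametric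
integrals. -/
theorem IsRelativeWeight.mem_Icc (hx : IsRelativeWeight x) (i : Fin n) : x i ∈ Icc (-1) (n : ℝ) := by
  refine ⟨(hx.gt i).le, ?_⟩
  have h1 : ∑ j, (1 + x j) = n := by simp [Finset.sum_add_distrib, hx.sum_eq_zero]
  have h2 := Finset.single_le_sum (f := fun j => 1 + x j)
    (fun j _ => by linarith [hx.gt j]) (Finset.mem_univ i)
  simp only [h1] at h2
  linarith

theorem entropyAlong_zero (x : Fin n → ℝ) : entropyAlong x 0 = 0 := by simp [entropyAlong]

theorem IsRelativeWeight.entropyAlong_nonneg (hx : IsRelativeWeight x) {t : ℝ}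
    (ht : t ∈ Icc (0 : ℝ) 1) : 0 ≤ entropyAlong x t := by
  have h : ∑ i, Real.log (1 + t * x i) ≤ 0 := by
    calc ∑ i, Real.log (1 + t * x i) ≤ ∑ i, t * x i := Finset.sum_le_sum fun i _ => by
          linarith [Real.log_le_sub_one_of_pos (hx.one_add_pos ht i)]
      _ = 0 := by rw [← Finset.mul_sum, hx.sum_eq_zero, mul_zero]
  unfold entropyAlong
  rw [neg_mul, ← mul_neg]
  exact mul_nonneg (by positivity) (by linarith)

theorem IsRelativeWeight.convexOn_entropyAlong (hx : IsRelativeWeight x) :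
    ConvexOn ℝ (Icc (0 : ℝ) 1) (entropyAlong x) := by
  refine ⟨convex_Icc 0 1, fun s hs t ht a b ha hb hab => ?_⟩
  have h (i : Fin n) : a * Real.log (1 + s * x i) + b * Real.log (1 + t * x i)
      ≤ Real.log (1 + (a * s + b * t) * x i) := by
    have := strictConcaveOn_log_Ioi.concaveOn.2 (hx.one_add_pos hs i) (hx.one_add_pos ht i) ha hb hab
    simp only [smul_eq_mul] at this
    rwa [show a * (1 + s * x i) + b * (1 + t * x i) = 1 + (a * s + b * t) * x i by
      linear_combination hab] at this
  have h' := Finset.sum_le_sum fun i (_ : i ∈ Finset.univ) => h i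
  rw [Finset.sum_add_distrib, ← Finset.mul_sum, ← Finset.mul_sum] at h'
  have hn : (0 : ℝ) ≤ 1 / n := by positivity
  simp only [entropyAlong, smul_eq_mul]
  nlinarith [mul_le_mul_of_nonneg_left h' hn]

theorem IsRelativeWeight.strictConvexOn_entropyAlong (hx : IsRelativeWeight x) (hx0 : x ≠ 0) :
    StrictConvexOn ℝ (Icc (0 : ℝ) 1) (entropyAlong x) := by
  refine ⟨convex_Icc 0 1, fun s hs t ht hst a b ha hb hab => ?_⟩
  have h (i : Fin n) : a * Real.log (1 + s * x i) + b * Real.log (1 + t * x i)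
      ≤ Real.log (1 + (a * s + b * t) * x i) := by
    have := strictConcaveOn_log_Ioi.concaveOn.2 (hx.one_add_pos hs i) (hx.one_add_pos ht i)
      ha.le hb.le hab
    simp only [smul_eq_mul] at this
    rwa [show a * (1 + s * x i) + b * (1 + t * x i) = 1 + (a * s + b * t) * x i by
      linear_combination hab] at this
  obtain ⟨j, hj⟩ := Function.ne_iff.1 hx0
  simp only [Pi.zero_apply] at hj
  have hlt : a * Real.log (1 + s * x j) + b * Real.log (1 + t * x j)
      < Real.log (1 + (a * s + b * t) * x j) := by
    have := strictConcaveOn_log_Ioi.2 (hx.one_add_pos hs j) (hx.one_add_pos ht j)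
      -- Since `x j ≠ 0`, distinct times give distinct arguments of the strictly concave logarithm;
      -- one such coordinate is enough.
      (fun h => hst (mul_right_cancel₀ hj (by linarith))) ha hb hab
    simp only [smul_eq_mul] at this
    rwa [show a * (1 + s * x j) + b * (1 + t * x j) = 1 + (a * s + b * t) * x j by
      linear_combination hab] at this
  have h' := Finset.sum_lt_sum (fun i (_ : i ∈ Finset.univ) => h i) ⟨j, Finset.mem_univ j, hlt⟩
  rw [Finset.sum_add_distrib, ← Finset.mul_sum, ← Finset.mul_sum] at h'
  have hn : (0 : ℝ) < 1 / n := by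
    have : 0 < n := Fin.pos j
    positivity
  simp only [entropyAlong, smul_eq_mul]
  nlinarith [mul_lt_mul_of_pos_left h' hn]

/-- Convexity with value `0` at `0` bounds the function by `t` times its value at `1`. That value is
the dominating function for all `t`. -/
theorem IsRelativeWeight.entropyAlong_le (hx : IsRelativeWeight x) {t : ℝ}
    (ht : t ∈ Icc (0 : ℝ) 1) : entropyAlong x t ≤ entropyAlong x 1 := by
  have h := hx.convexOn_entropyAlong.2 (left_mem_Icc.2 zero_le_one) (right_mem_Icc.2 zero_le_one)
    (sub_nonneg.2 ht.2) ht.1 (by ring)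
  simp only [smul_eq_mul, mul_zero, mul_one, zero_add, entropyAlong_zero] at h
  nlinarith [hx.entropyAlong_nonneg (right_mem_Icc.2 zero_le_one), ht.2]

variable {Ω : Type*} [MeasurableSpace Ω] {μ : Measure Ω}
  {X : Ω → Fin n → ℝ}

theorem integrable_entropyAlong (hX : AEMeasurable X μ) (hw : ∀ᵐ ω ∂μ, IsRelativeWeight (X ω))
    (h1 : Integrable (fun ω => entropyAlong (X ω) 1) μ) {t : ℝ} (ht : t ∈ Icc (0 : ℝ) 1) :
    Integrable (fun ω => entropyAlong (X ω) t) μ := by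
  refine h1.mono' ?_ (hw.mono fun ω hω => ?_)
  · have (i : Fin n) : AEMeasurable (fun ω => X ω i) μ := (measurable_pi_apply i).comp_aemeasurable hX
    unfold entropyAlong
    exact AEMeasurable.aestronglyMeasurable (by fun_prop)
  · rw [Real.norm_of_nonneg (hω.entropyAlong_nonneg ht)]
    exact hω.entropyAlong_le ht

theorem contDiffOn_integral_entropyAlong [IsProbabilityMeasure μ] (hn : 0 < n) (hX : AEMeasurable X μ)
    (hw : ∀ᵐ ω ∂μ, IsRelativeWeight (X ω)) :
    ContDiffOn ℝ (⊤ : ℕ∞) (fun t => ∫ ω, entropyAlong (X ω) t ∂μ) (Ico 0 1) := by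
  have hn' : (0 : ℝ) < n := Nat.cast_pos.2 hn
  have hXi (i : Fin n) : AEMeasurable (fun ω => X ω i) μ :=
    (measurable_pi_apply i).comp_aemeasurable hX
  have hI (i : Fin n) : ∀ᵐ ω ∂μ, X ω i ∈ Icc (-1) (n : ℝ) := hw.mono fun ω hω => hω.mem_Icc i
  have h : ContDiffOn ℝ (⊤ : ℕ∞)
      (fun t => -(1 / (n : ℝ)) * ∑ i, ∫ ω, Real.log (1 + t * X ω i) ∂μ) (Ico 0 1) := by
    refine contDiffOn_const.mul (ContDiffOn.sum fun i _ => ?_)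
    refine (contDiffOn_integral_log hn' (hXi i) (hI i)).mono fun t ht => ⟨?_, ht.2⟩
    exact (neg_neg_of_pos (by positivity)).trans_le ht.1
  refine h.congr fun t ht => ?_
  simp only [entropyAlong]
  rw [integral_const_mul, integral_finsetSum]
  exact fun i _ => integrable_log_one_add_mul (hXi i) hn' (hI i) ht

theorem continuousOn_integral_entropyAlong (hX : AEMeasurable X μ)
    (hw : ∀ᵐ ω ∂μ, IsRelativeWeight (X ω))
    (h1 : Integrable (fun ω => entropyAlong (X ω) 1) μ) :
    ContinuousOn (fun t => ∫ ω, entropyAlong (X ω) t ∂μ) (Icc 0 1) := by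
  refine continuousOn_of_dominated (bound := fun ω => entropyAlong (X ω) 1)
    (fun t ht => (integrable_entropyAlong hX hw h1 ht).aestronglyMeasurable)
    (fun t ht => hw.mono fun ω hω => ?_) h1 (hw.mono fun ω hω => ?_)
  · rw [Real.norm_of_nonneg (hω.entropyAlong_nonneg ht)]
    exact hω.entropyAlong_le ht
  · unfold entropyAlong
    refine ContinuousOn.mul (by fun_prop) (continuousOn_finsetSum _ fun i _ => ?_)
    exact ContinuousOn.log (by fun_prop) fun t ht => (hω.one_add_pos ht i).ne'

theorem strictConvexOn_integral_entropyAlong (hX : AEMeasurable X μ)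
    (hw : ∀ᵐ ω ∂μ, IsRelativeWeight (X ω))
    (h1 : Integrable (fun ω => entropyAlong (X ω) 1) μ) (hne : ¬ ∀ᵐ ω ∂μ, X ω = 0) :
    StrictConvexOn ℝ (Icc 0 1) (fun t => ∫ ω, entropyAlong (X ω) t ∂μ) := by
  refine ⟨convex_Icc 0 1, fun s hs t ht hst a b ha hb hab => ?_⟩
  have hm : a • s + b • t ∈ Icc (0 : ℝ) 1 := convex_Icc (0 : ℝ) 1 hs ht ha.le hb.le hab
  have is := integrable_entropyAlong hX hw h1 hs
  have it := integrable_entropyAlong hX hw h1 ht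
  have im := integrable_entropyAlong hX hw h1 hm
  have ist := (is.const_mul a).add (it.const_mul b)
  have hle : ∀ᵐ ω ∂μ, entropyAlong (X ω) (a • s + b • t)
      ≤ a * entropyAlong (X ω) s + b * entropyAlong (X ω) t :=
    hw.mono fun ω hω => hω.convexOn_entropyAlong.2 hs ht ha.le hb.le hab
  simp only [smul_eq_mul a (∫ _, _ ∂μ), smul_eq_mul b (∫ _, _ ∂μ)]
  rw [← integral_const_mul, ← integral_const_mul, ← integral_add (is.const_mul a) (it.const_mul b)]
  -- Equal integrals of ordered functions would force equality almost everywhere, against strict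
  -- convexity wherever `X ω ≠ 0`.
  refine lt_of_le_of_ne (integral_mono_ae im ist hle) fun heq => hne ?_
  have hae := (integral_eq_iff_of_ae_le im ist hle).1 heq
  filter_upwards [hae, hw] with ω h2 hω
  by_contra hc
  exact ((hω.strictConvexOn_entropyAlong hc).2 hs ht hst ha hb hab).ne h2

/-- A nonnegative strictly convex function on `[0, 1]` that vanishes at `0` is strictly
increasing. -/
theorem strictMonoOn_of_strictConvexOn_of_nonneg {f : ℝ → ℝ} (hf : StrictConvexOn ℝ (Icc 0 1) f)
    (h0 : f 0 = 0) (hnn : ∀ t ∈ Icc (0 : ℝ) 1, 0 ≤ f t) : StrictMonoOn f (Icc 0 1) := by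
  have h0m : (0 : ℝ) ∈ Icc (0 : ℝ) 1 := left_mem_Icc.2 zero_le_one
  have key : ∀ s t : ℝ, 0 < s → s < t → t ≤ 1 → f s < s / t * f t := by
    intro s t hs hst ht
    have ht0 : 0 < t := hs.trans hst
    have h := hf.2 h0m ⟨ht0.le, ht⟩ ht0.ne (sub_pos.2 ((div_lt_one ht0).2 hst))
      (div_pos hs ht0) (by ring)
    simpa [h0, div_mul_cancel₀ _ ht0.ne'] using h
  intro s hs t ht hst
  have ht0 : 0 < t := hs.1.trans_lt hst
  rcases hs.1.eq_or_lt with rfl | hs0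
  -- `key` needs a positive first time, so positivity of `f t` is read off from `0 ≤ f (t / 2) < f t
  -- / 2`.
  · have h := key (t / 2) t (by linarith) (by linarith) ht.2
    have h' := hnn (t / 2) ⟨by linarith, by linarith [ht.2]⟩
    rw [h0]
    exact pos_of_mul_pos_right (h'.trans_lt h) (by positivity)
  · refine (key s t hs0 hst ht.2).trans_le ?_
    exact mul_le_of_le_one_left (hnn t ht) ((div_le_one ht0).2 hst.le)

end Entropy

/-! ### The maps `T_t`: Lipschitz inverses, measurability and the class `𝓛ₐ`. -/

section Interpolation

variable {n : ℕ} {φ : (Fin n → ℝ) → ℝ} {r s p : Fin n → ℝ} {t : ℝ}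

theorem portfolioMapAt_apply (φ : (Fin n → ℝ) → ℝ) (t : ℝ) (r : Fin n → ℝ) (i : Fin n) :
    portfolioMapAt φ t r i = (1 - t) * (1 / n) + t * portfolioMap φ r i := by
  simp [portfolioMapAt, barycenter]

theorem IsSupported.sum_portfolioMapAt (hn : 1 ≤ n) (h : IsSupported φ r) (t : ℝ) :
    ∑ i, portfolioMapAt φ t r i = 1 := by
  have : (n : ℝ) ≠ 0 := by positivity
  simp only [portfolioMapAt_apply, Finset.sum_add_distrib, ← Finset.mul_sum, h.sum_eq_one]
  simp [this]

theorem IsSupported.le_portfolioMapAt (h : IsSupported φ r) (ht : 0 ≤ t) (i : Fin n) :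
    (1 - t) / n ≤ portfolioMapAt φ t r i := by
  rw [portfolioMapAt_apply]
  have := mul_nonneg ht (h.nonneg i)
  rw [mul_one_div]
  linarith

theorem IsSupported.portfolioMapAt_nonneg (h : IsSupported φ r) (ht : t ∈ Icc (0 : ℝ) 1)
    (i : Fin n) : 0 ≤ portfolioMapAt φ t r i :=
  (div_nonneg (sub_nonneg.2 ht.2) (Nat.cast_nonneg n)).trans (h.le_portfolioMapAt ht.1 i)

theorem IsSupported.portfolioMapAt_pos (h : IsSupported φ r) (ht : t ∈ Ico (0 : ℝ) 1)
    (i : Fin n) : 0 < portfolioMapAt φ t r i :=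
  (div_pos (sub_pos.2 ht.2) (Nat.cast_pos.2 (Fin.pos i))).trans_le (h.le_portfolioMapAt ht.1 i)

/-- A weighted average with weights in a simplex is positive if the other vector is. -/
theorem sum_mul_pos_of_sum_eq_one {w : Fin n → ℝ} (hp : ∀ i, 0 < p i) (hw : ∀ i, 0 ≤ w i)
    (hw1 : ∑ i, w i = 1) : 0 < ∑ i, p i * w i := by
  refine (Finset.sum_nonneg fun i _ => mul_nonneg (hp i).le (hw i)).lt_of_ne' fun h0 => ?_
  rw [Finset.sum_eq_zero_iff_of_nonneg fun i _ => mul_nonneg (hp i).le (hw i)] at h0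
  have : ∑ i, w i = 0 := Finset.sum_eq_zero fun i hi =>
    (mul_eq_zero.1 (h0 i hi)).resolve_left (hp i).ne'
  rw [hw1] at this
  exact one_ne_zero this

theorem perturb_mem (hn : 2 ≤ n) {w : Fin n → ℝ} (hp : ∀ i, 0 < p i) (hw : ∀ i, 0 < w i) :
    perturb p w ∈ openSimplex n := by
  have : Nonempty (Fin n) := ⟨⟨0, by omega⟩⟩
  have hD : 0 < ∑ i, p i * w i :=
    Finset.sum_pos (fun i _ => mul_pos (hp i) (hw i)) Finset.univ_nonempty
  rw [mem_openSimplex_iff hn]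
  refine ⟨fun i => div_pos (mul_pos (hp i) (hw i)) hD, ?_⟩
  simp only [perturb]
  rw [← Finset.sum_div, div_self hD.ne']

/-- `p ⊙ w` in terms of the inverse of `p`. -/
theorem perturb_eq (hn : 1 ≤ n) (hp : p ∈ openSimplex n) (w : Fin n → ℝ) :
    perturb p w = fun i => w i / simplexInv p i / ∑ j, w j / simplexInv p j := by
  have hS := one_le_sum_inv hn hp
  have h (i : Fin n) : w i / simplexInv p i = (p i * w i) * ∑ j, 1 / p j := by
    rw [div_eq_mul_one_div, one_div_simplexInv]; ring
  funext i
  simp only [perturb, h, ← Finset.sum_mul]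
  rw [mul_div_mul_right _ _ (by linarith)]

theorem IsSupported.sum_div_mul_self (h : IsSupported φ r) (hr : r ∈ openSimplex n) :
    ∑ i, portfolioMap φ r i / r i * r i = 1 := by
  rw [← h.sum_eq_one]
  exact Finset.sum_congr rfl fun i _ => div_mul_cancel₀ _ (hr.1 i).1.ne'

/-- Multiply the supporting inequalities at `r` and at `s`: the exponentials cancel. This is
two-point cyclical monotonicity in multiplicative form. -/
theorem IsSupported.one_le_mul (hr : r ∈ openSimplex n) (hs : s ∈ openSimplex n)
    (h : IsSupported φ r) (h' : IsSupported φ s) :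
    1 ≤ (∑ i, portfolioMap φ r i / r i * s i) * ∑ i, portfolioMap φ s i / s i * r i := by
  calc (1 : ℝ) = Real.exp (φ s - φ r) * Real.exp (φ r - φ s) := by
        rw [← Real.exp_add]; simp
    _ ≤ _ := mul_le_mul (h.le s hs) (h'.le r hr) (Real.exp_pos _).le
        ((Real.exp_pos _).le.trans (h.le s hs))

/-- Monotonicity of the gradient of the logarithm of the homogeneous extension of `exp φ`. -/
theorem IsSupported.sum_mul_nonpos (hr : r ∈ openSimplex n) (hs : s ∈ openSimplex n)
    (h : IsSupported φ r) (h' : IsSupported φ s) {a b : ℝ} (ha : 0 < a) (hb : 0 < b) :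
    ∑ i, (portfolioMap φ r i / r i / a - portfolioMap φ s i / s i / b) * (a * r i - b * s i)
      ≤ 0 := by
  set A := ∑ i, portfolioMap φ r i / r i * s i with hA
  set B := ∑ i, portfolioMap φ s i / s i * r i with hB
  have hAB : 1 ≤ A * B := h.one_le_mul hr hs h'
  have hA0 : 0 < A := (Real.exp_pos _).trans_le (h.le s hs)
  have hB0 : 0 < B := (Real.exp_pos _).trans_le (h'.le r hr)
  have key : ∑ i, (portfolioMap φ r i / r i / a - portfolioMap φ s i / s i / b)
      * (a * r i - b * s i) = 1 + 1 - b / a * A - a / b * B := by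
    nth_rewrite 1 [← h.sum_div_mul_self hr]
    rw [← h'.sum_div_mul_self hs, hA, hB, Finset.mul_sum, Finset.mul_sum, ← Finset.sum_add_distrib,
      ← Finset.sum_sub_distrib, ← Finset.sum_sub_distrib]
    refine Finset.sum_congr rfl fun i _ => ?_
    generalize portfolioMap φ r i / r i = w
    generalize portfolioMap φ s i / s i = w'
    field_simp
    ring
  rw [key]
  have h1 : (b / a * A) * (a / b * B) = A * B := by field_simp
  have h2 : 0 < b / a * A := by positivity
  have h3 : 0 < a / b * B := by positivity
  -- Two positive numbers with product at least `1` have sum at least `2`.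
  nlinarith [sq_nonneg (b / a * A - a / b * B)]

theorem sq_norm_le_sum_sq (x : Fin n → ℝ) : ‖x‖ ^ 2 ≤ ∑ i, x i ^ 2 := by
  have h0 : 0 ≤ ∑ i, x i ^ 2 := Finset.sum_nonneg fun i _ => sq_nonneg _
  have : ‖x‖ ≤ √(∑ i, x i ^ 2) := (pi_norm_le_iff_of_nonneg (Real.sqrt_nonneg _)).2 fun i =>
    Real.abs_le_sqrt (Finset.single_le_sum (f := fun i => x i ^ 2) (fun j _ => sq_nonneg _)
      (Finset.mem_univ i))
  calc ‖x‖ ^ 2 ≤ √(∑ i, x i ^ 2) ^ 2 := pow_le_pow_left₀ (norm_nonneg _) this 2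
    _ = _ := Real.sq_sqrt h0

theorem abs_sum_mul_le (x y : Fin n → ℝ) : |∑ i, x i * y i| ≤ n * (‖x‖ * ‖y‖) := by
  calc |∑ i, x i * y i| ≤ ∑ i, |x i * y i| := Finset.abs_sum_le_sum_abs _ _
    _ ≤ ∑ _i : Fin n, ‖x‖ * ‖y‖ := Finset.sum_le_sum fun i _ => by
        rw [abs_mul]
        exact mul_le_mul (norm_le_pi_norm x i) (norm_le_pi_norm y i) (abs_nonneg _) (norm_nonneg _)
    _ = n * (‖x‖ * ‖y‖) := by simp

/-- The normalizing constant of `π_t / r`. -/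
noncomputable def slopeSum (φ : (Fin n → ℝ) → ℝ) (t : ℝ) (r : Fin n → ℝ) : ℝ :=
  ∑ i, portfolioMapAt φ t r i / r i

theorem IsSupported.one_le_slopeSum (hn : 1 ≤ n) (h : IsSupported φ r) (hr : r ∈ openSimplex n)
    (ht : t ∈ Icc (0 : ℝ) 1) : 1 ≤ slopeSum φ t r := by
  rw [← h.sum_portfolioMapAt hn t]
  exact Finset.sum_le_sum fun i _ =>
    le_div_self (h.portfolioMapAt_nonneg ht i) (hr.1 i).1 (hr.1 i).2.le

theorem IsSupported.slopeSum_le (hn : 1 ≤ n) (h : IsSupported φ r) (ht : t ∈ Icc (0 : ℝ) 1)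
    {M : ℝ} (hM : ∀ i, 1 / r i ≤ M) : slopeSum φ t r ≤ M := by
  have : ∑ i, portfolioMapAt φ t r i * M = M := by
    rw [← Finset.sum_mul, h.sum_portfolioMapAt hn t, one_mul]
  rw [← this]
  refine Finset.sum_le_sum fun i _ => ?_
  rw [div_eq_mul_one_div]
  exact mul_le_mul_of_nonneg_left (hM i) (h.portfolioMapAt_nonneg ht i)

/-- The interpolated map is bounded below where the inverse is away from the boundary. -/
theorem IsSupported.norm_sub_le (hn : 2 ≤ n) (hr : r ∈ openSimplex n) (hs : s ∈ openSimplex n)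
    (h : IsSupported φ r) (h' : IsSupported φ s) (ht : t ∈ Ico (0 : ℝ) 1) {M : ℝ}
    (hrM : ∀ i, 1 / r i ≤ M) (hsM : ∀ i, 1 / s i ≤ M) :
    ‖r - s‖ ≤ (1 + n) * (n ^ 2 * M ^ 2 / (1 - t)) *
      ‖(fun i => portfolioMapAt φ t r i / r i / slopeSum φ t r)
        - (fun i => portfolioMapAt φ t s i / s i / slopeSum φ t s)‖ := by
  have htI := Ico_subset_Icc_self ht
  have ht1 : 0 < 1 - t := sub_pos.2 ht.2
  have hn0 : (0 : ℝ) < n := Nat.cast_pos.2 (by omega)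
  set a := slopeSum φ t r with ha
  set b := slopeSum φ t s with hb
  have ha1 : 1 ≤ a := h.one_le_slopeSum (by omega) hr htI
  have hb1 : 1 ≤ b := h'.one_le_slopeSum (by omega) hs htI
  have haM : a ≤ M := h.slopeSum_le (by omega) htI hrM
  have hbM : b ≤ M := h'.slopeSum_le (by omega) htI hsM
  -- At the rescaled point `x = a r`, the map value `𝛑_t / r / a` is `(1-t)/n · 1/x_i` plus `t`
  -- times the gradient at `x` of the logarithm of the homogeneous extension of `exp φ`. The points
  -- `r` and `s` are recovered by normalization.
  set x : Fin n → ℝ := fun i => a * r i with hx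
  set y : Fin n → ℝ := fun i => b * s i with hy
  set q : Fin n → ℝ := (fun i => portfolioMapAt φ t r i / r i / a)
        - (fun i => portfolioMapAt φ t s i / s i / b) with hq
  have hxy : ‖r - s‖ ≤ (1 + n) * ‖x - y‖ := by
    have hxs : ∑ i, x i = a := by rw [hx, ← Finset.mul_sum, hr.2, mul_one]
    have hys : ∑ i, y i = b := by rw [hy, ← Finset.mul_sum, hs.2, mul_one]
    have := norm_normalize_sub_le hxs hys ha1 hb1
      fun i => mul_nonneg (by linarith) (hs.1 i).1.le
    have e1 : (fun i => x i / a) = r := by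
      funext i; exact mul_div_cancel_left₀ _ (by linarith)
    have e2 : (fun i => y i / b) = s := by
      funext i; exact mul_div_cancel_left₀ _ (by linarith)
    rwa [e1, e2] at this
  have hterm (i : Fin n) : q i * (x i - y i)
      = -((1 - t) / n) * ((x i - y i) ^ 2 / (x i * y i)) +
        t * ((portfolioMap φ r i / r i / a - portfolioMap φ s i / s i / b)
          * (a * r i - b * s i)) := by
    have := (hr.1 i).1
    have := (hs.1 i).1
    have : 0 < a := by linarith
    have : 0 < b := by linarith
    simp only [hq, hx, hy, Pi.sub_apply, portfolioMapAt_apply]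
    field_simp
    ring
  -- The `φ` part has a favourable sign by monotonicity; the barycentric part `1/x_i` supplies the
  -- quadratic term, which survives because `t < 1`.
  have hsum : (1 - t) / n * ∑ i, (x i - y i) ^ 2 / (x i * y i) ≤ -∑ i, q i * (x i - y i) := by
    rw [Finset.sum_congr rfl fun i _ => hterm i, Finset.sum_add_distrib, ← Finset.mul_sum,
      ← Finset.mul_sum]
    have := mul_nonpos_of_nonneg_of_nonpos ht.1
      (h.sum_mul_nonpos hr hs h' (show 0 < a by linarith) (show 0 < b by linarith))
    linarith
  have hup : -∑ i, q i * (x i - y i) ≤ n * (‖q‖ * ‖x - y‖) :=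
    (neg_le_abs _).trans (abs_sum_mul_le q (x - y))
  have hlow : ‖x - y‖ ^ 2 / M ^ 2 ≤ ∑ i, (x i - y i) ^ 2 / (x i * y i) := by
    refine (div_le_div_of_nonneg_right (sq_norm_le_sum_sq (x - y)) (sq_nonneg M)).trans ?_
    rw [Finset.sum_div]
    refine Finset.sum_le_sum fun i _ => ?_
    have hxi : 0 < x i := mul_pos (by linarith) (hr.1 i).1
    have hyi : 0 < y i := mul_pos (by linarith) (hs.1 i).1
    have hxM : x i ≤ M := (mul_le_of_le_one_right (by linarith) (hr.1 i).2.le).trans haM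
    have hyM : y i ≤ M := (mul_le_of_le_one_right (by linarith) (hs.1 i).2.le).trans hbM
    rw [pow_two M]
    exact div_le_div_of_nonneg_left (sq_nonneg _) (mul_pos hxi hyi)
      (mul_le_mul hxM hyM hyi.le (by linarith))
  have hM : 0 < M := by linarith
  have hfin : ‖x - y‖ ≤ n ^ 2 * M ^ 2 / (1 - t) * ‖q‖ := by
    have h1 : (1 - t) / n * (‖x - y‖ ^ 2 / M ^ 2) ≤ n * (‖q‖ * ‖x - y‖) :=
      (mul_le_mul_of_nonneg_left hlow (by positivity)).trans (hsum.trans hup)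
    rcases (norm_nonneg (x - y)).eq_or_lt with h0 | h0
    · rw [← h0]; positivity
    · rw [div_mul_div_comm, div_le_iff₀ (by positivity)] at h1
      have h2 : (1 - t) * ‖x - y‖ ≤ n ^ 2 * M ^ 2 * ‖q‖ := by
        refine le_of_mul_le_mul_right ?_ h0
        linarith
      rw [div_mul_eq_mul_div, le_div_iff₀ ht1]
      linarith
  calc ‖r - s‖ ≤ (1 + n) * ‖x - y‖ := hxy
    _ ≤ (1 + n) * (n ^ 2 * M ^ 2 / (1 - t) * ‖q‖) :=
        mul_le_mul_of_nonneg_left hfin (by positivity)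
    _ = _ := by ring

theorem transportMapAt_eq (hn : 1 ≤ n) (hp : p ∈ openSimplex n) :
    transportMapAt φ t p = fun i => portfolioMapAt φ t (simplexInv p) i / simplexInv p i /
      slopeSum φ t (simplexInv p) :=
  perturb_eq hn hp _

theorem IsSupported.transportMapAt_mem (hn : 2 ≤ n) (hp : p ∈ openSimplex n)
    (h : IsSupported φ (simplexInv p)) (ht : t ∈ Ico (0 : ℝ) 1) :
    transportMapAt φ t p ∈ openSimplex n :=
  perturb_mem hn (fun i => (hp.1 i).1) (h.portfolioMapAt_pos ht)

/-- Before time `1` the preimages of null sets are null. -/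
theorem simplexLebesgue_preimage_transportMapAt (hn : 2 ≤ n) (ht : t ∈ Ico (0 : ℝ) 1)
    {N : Set (Fin n → ℝ)} (hN : simplexLebesgue n N = 0) :
    simplexLebesgue n {p | p ∈ openSimplex n ∧ IsSupported φ (simplexInv p) ∧
      transportMapAt φ t p ∈ N} = 0 := by
  refine measure_mono_null (t := ⋃ M : ℕ, {p | (p ∈ openSimplex n ∧ IsSupported φ (simplexInv p) ∧
      transportMapAt φ t p ∈ N) ∧ ∀ i, 1 / simplexInv p i ≤ M}) ?_ (measure_iUnion_null fun M => ?_)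
  · intro p hp
    obtain ⟨M, hM⟩ := exists_nat_ge (∑ i, 1 / simplexInv p i)
    refine mem_iUnion.2 ⟨M, hp, fun i => le_trans ?_ hM⟩
    exact Finset.single_le_sum (f := fun i => 1 / simplexInv p i)
      (fun j _ => zero_le_one.trans (one_le_inv_of_mem (simplexInv_mem hn hp.1) j))
      (Finset.mem_univ i)
  · refine simplexLebesgue_eq_zero_of_antilipschitz hn (F := transportMapAt φ t)
      -- The product of two constants: recovering `p` from `p⁻¹`, and `p⁻¹` from `T_t p`.
      (K := (1 + n) * (M : ℝ) ^ 2 * ((1 + n) * (n ^ 2 * (M : ℝ) ^ 2 / (1 - t))))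
      (fun p hp => hp.1.1) (fun p hp q hq => ?_) (fun p hp => hp.1.2.2)
      (fun p hp => hp.1.2.1.transportMapAt_mem hn hp.1.1 ht) hN
    have hp' := simplexInv_mem hn hp.1.1
    have hq' := simplexInv_mem hn hq.1.1
    have h1 := norm_simplexInv_sub_le hn hp' hq' hp.2 hq.2
    rw [simplexInv_simplexInv hn hp.1.1, simplexInv_simplexInv hn hq.1.1] at h1
    have h2 := hp.1.2.1.norm_sub_le hn hp' hq' hq.1.2.1 ht hp.2 hq.2
    rw [← transportMapAt_eq (by omega) hp.1.1, ← transportMapAt_eq (by omega) hq.1.1] at h2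
    refine h1.trans ?_
    rw [mul_assoc ((1 + n) * (M : ℝ) ^ 2)]
    exact mul_le_mul_of_nonneg_left h2 (by positivity)

theorem perturb_div_normalize {w : Fin n → ℝ} (hp : ∀ i, 0 < p i) (hw : ∀ i, 0 ≤ w i)
    (hw1 : ∑ i, w i = 1) (i : Fin n) :
    w i = perturb p w i / p i / ∑ j, perturb p w j / p j := by
  have hD := sum_mul_pos_of_sum_eq_one hp hw hw1
  have h (j : Fin n) : perturb p w j / p j = w j / ∑ k, p k * w k := by
    have := (hp j).ne'
    simp only [perturb]
    field_simp
  simp only [h, ← Finset.sum_div, hw1]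
  field_simp

theorem transportMapAt_one (φ : (Fin n → ℝ) → ℝ) : transportMapAt φ 1 = transportMap φ := by
  funext p
  simp [transportMapAt, transportMap, portfolioMapAt]

variable {P₀ P₁ : Measure (Fin n → ℝ)}

/-- The weights are recovered from `p` and `T p` by dividing and normalizing
(`perturb_div_normalize`), so they inherit measurability from `T`, with no study of the directional
derivatives. -/
theorem aemeasurable_portfolioMap (hn : 2 ≤ n) (h₀ : ClassLa P₀) (hφ : ExpConcave φ)
    (hT : AEMeasurable (transportMap φ) P₀) :
    AEMeasurable (fun p => portfolioMap φ (simplexInv p)) P₀ := by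
  have hTi (i : Fin n) : AEMeasurable (fun p => transportMap φ p i) P₀ :=
    (measurable_pi_apply i).comp_aemeasurable hT
  have h : AEMeasurable (fun p i => transportMap φ p i / p i / ∑ j, transportMap φ p j / p j)
      P₀ := by
    have hq (i : Fin n) : AEMeasurable (fun p => transportMap φ p i / p i) P₀ :=
      (hTi i).div (measurable_pi_apply i).aemeasurable
    exact aemeasurable_pi_lambda _ fun i => (hq i).div
      (Finset.aemeasurable_fun_sum _ fun j _ => hq j)
  refine h.congr ?_
  filter_upwards [hφ.ae_isSupported hn h₀, h₀.toClassL.ae_mem] with p hs hp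
  funext i
  exact (perturb_div_normalize (fun j => (hp.1 j).1) hs.nonneg hs.sum_eq_one i).symm

theorem aemeasurable_transportMapAt (hn : 2 ≤ n) (h₀ : ClassLa P₀) (hφ : ExpConcave φ)
    (hT : AEMeasurable (transportMap φ) P₀) (t : ℝ) : AEMeasurable (transportMapAt φ t) P₀ := by
  have hw := aemeasurable_portfolioMap hn h₀ hφ hT
  have hwi (i : Fin n) : AEMeasurable (fun p => portfolioMap φ (simplexInv p) i) P₀ :=
    (measurable_pi_apply i).comp_aemeasurable hw
  refine aemeasurable_pi_lambda _ fun i => ?_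
  simp only [transportMapAt, perturb, portfolioMapAt_apply]
  have hq (i : Fin n) : AEMeasurable
      (fun p => p i * ((1 - t) * (1 / n) + t * portfolioMap φ (simplexInv p) i)) P₀ :=
    (measurable_pi_apply i).aemeasurable.mul (((hwi i).const_mul t).const_add _)
  exact (hq i).div (Finset.aemeasurable_fun_sum _ fun j _ => hq j)

theorem abs_log_eq_neg_log (hp : p ∈ openSimplex n) (i : Fin n) :
    |Real.log (p i)| = -Real.log (p i) :=
  abs_of_nonpos (Real.log_nonpos (hp.1 i).1.le (hp.1 i).2.le)

/-- The weights are at least `(1-t)/n` and the normalizing sum is at most `1`, so `T_t(p)_i ≥ p_i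
(1-t)/n`. -/
theorem IsSupported.abs_log_transportMapAt_le (hn : 2 ≤ n) (hp : p ∈ openSimplex n)
    (h : IsSupported φ (simplexInv p)) (ht : t ∈ Ico (0 : ℝ) 1) (i : Fin n) :
    |Real.log (transportMapAt φ t p i)| ≤ |Real.log (p i)| + -Real.log ((1 - t) / n) := by
  have hn0 : (0 : ℝ) < n := Nat.cast_pos.2 (by omega)
  have hc : 0 < (1 - t) / n := div_pos (sub_pos.2 ht.2) hn0
  have hpi := (hp.1 i).1
  rw [abs_log_eq_neg_log (h.transportMapAt_mem hn hp ht), abs_log_eq_neg_log hp, ← neg_add,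
    ← Real.log_mul hpi.ne' hc.ne']
  refine neg_le_neg (Real.log_le_log (mul_pos hpi hc) ?_)
  have hD : ∑ j, p j * portfolioMapAt φ t (simplexInv p) j ≤ 1 := by
    rw [← h.sum_portfolioMapAt (by omega) t]
    exact Finset.sum_le_sum fun j _ =>
      mul_le_of_le_one_left (h.portfolioMapAt_pos ht j).le (hp.1 j).2.le
  calc p i * ((1 - t) / n) ≤ p i * portfolioMapAt φ t (simplexInv p) i :=
        mul_le_mul_of_nonneg_left (h.le_portfolioMapAt ht.1 i) hpi.le
    _ ≤ _ := le_div_self (mul_pos hpi (h.portfolioMapAt_pos ht i)).le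
        (sum_mul_pos_of_sum_eq_one (fun j => (hp.1 j).1)
          (fun j => (h.portfolioMapAt_pos ht j).le) (h.sum_portfolioMapAt (by omega) t)) hD

/-- The class `𝓛ₐ` is preserved by the interpolation before time `1`. -/
theorem classLa_map_transportMapAt (hn : 2 ≤ n) (h₀ : ClassLa P₀) (hφ : ExpConcave φ)
    (hT : AEMeasurable (transportMap φ) P₀) (ht : t ∈ Ico (0 : ℝ) 1) :
    ClassLa (P₀.map (transportMapAt φ t)) := by
  have := h₀.isProbabilityMeasure
  have hTt := aemeasurable_transportMapAt hn h₀ hφ hT t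
  have hs := hφ.ae_isSupported hn h₀
  have hm := h₀.toClassL.ae_mem
  have hmem : ∀ᵐ p ∂P₀, transportMapAt φ t p ∈ openSimplex n := by
    filter_upwards [hs, hm] with p h1 h2 using h1.transportMapAt_mem hn h2 ht
  refine ⟨⟨Measure.isProbabilityMeasure_map hTt, ?_, ?_⟩, ?_⟩
  · rw [Measure.map_apply_of_aemeasurable hTt (measurableSet_openSimplex n).compl]
    exact hmem
  · refine ENNReal.sum_lt_top.2 fun i _ => ?_
    rw [lintegral_map' (Measurable.aemeasurable (by fun_prop)) hTt]
    have hi : ∫⁻ p, ENNReal.ofReal |Real.log (p i)| ∂P₀ < ⊤ :=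
      ENNReal.sum_lt_top.1 h₀.log_moment i (Finset.mem_univ i)
    calc ∫⁻ p, ENNReal.ofReal |Real.log (transportMapAt φ t p i)| ∂P₀
        ≤ ∫⁻ p, (ENNReal.ofReal |Real.log (p i)| + ENNReal.ofReal (-Real.log ((1 - t) / n))) ∂P₀ := by
          refine lintegral_mono_ae ?_
          filter_upwards [hs, hm] with p h1 h2
          exact (ENNReal.ofReal_le_ofReal (h1.abs_log_transportMapAt_le hn h2 ht i)).trans
            ENNReal.ofReal_add_le
      _ < ⊤ := by
          rw [lintegral_add_right _ measurable_const]
          exact ENNReal.add_lt_top.2 ⟨hi, by simp⟩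
  · refine Measure.AbsolutelyContinuous.mk fun N hN hN0 => ?_
    rw [Measure.map_apply_of_aemeasurable hTt hN]
    have h1 := h₀.absolutelyContinuous
      (simplexLebesgue_preimage_transportMapAt (φ := φ) hn ht hN0)
    have h2 := (measure_eq_zero_iff_ae_notMem).1 h1
    refine (measure_eq_zero_iff_ae_notMem).2 ?_
    filter_upwards [h2, hs, hm] with p h3 h4 h5 h6
    exact h3 ⟨h5, h4, h6⟩

end Interpolation

/-! ### Logarithmic duality and certificates of optimality. -/

section Duality

variable {n : ℕ} {φ : (Fin n → ℝ) → ℝ} {p q r s : Fin n → ℝ} {t : ℝ}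

theorem sum_mul_pos_of_mem (hr : r ∈ openSimplex n) (hq : q ∈ openSimplex n) :
    0 < ∑ i, r i * q i :=
  sum_mul_pos_of_sum_eq_one (fun i => (hr.1 i).1) (fun i => (hq.1 i).1.le) hq.2

theorem sum_mul_le_one_of_mem (hr : r ∈ openSimplex n) (hq : q ∈ openSimplex n) :
    ∑ i, r i * q i ≤ 1 := by
  rw [← hq.2]
  exact Finset.sum_le_sum fun i _ => mul_le_of_le_one_left (hq.1 i).1.le (hr.1 i).2.le

/-- The cost is, up to a function of `p` and a function of `q`, a logarithmic pairing. -/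
theorem cost_eq_log_pairing (hn : 2 ≤ n) (hp : p ∈ openSimplex n) (hq : q ∈ openSimplex n) :
    cost p q = Real.log (∑ i, simplexInv p i * q i) - Real.log n
      - 1 / n * ∑ i, Real.log (simplexInv p i) - 1 / n * ∑ i, Real.log (q i) := by
  have hn0 : (n : ℝ) ≠ 0 := by positivity
  have hr := simplexInv_mem hn hp
  have hS : 0 < ∑ j, 1 / p j := zero_lt_one.trans_le (one_le_sum_inv (by omega) hp)
  have h (i : Fin n) : q i / p i = (simplexInv p i * q i) * ∑ j, 1 / p j := by
    have := (hp.1 i).1.ne'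
    simp only [simplexInv]
    field_simp
  have hlog (i : Fin n) : Real.log (q i / p i) =
      Real.log (simplexInv p i) + Real.log (q i) + Real.log (∑ j, 1 / p j) := by
    rw [h, Real.log_mul (mul_pos (hr.1 i).1 (hq.1 i).1).ne' hS.ne',
      Real.log_mul (hr.1 i).1.ne' (hq.1 i).1.ne']
  have hsum : ∑ i, q i / p i = (∑ i, simplexInv p i * q i) * ∑ j, 1 / p j := by
    rw [Finset.sum_mul]; exact Finset.sum_congr rfl fun i _ => h i
  have hpos := sum_mul_pos_of_mem hr hq
  rw [cost, Finset.sum_congr rfl fun i _ => hlog i, hsum,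
    Real.log_mul (by positivity) (mul_pos hpos hS).ne', Real.log_mul hpos.ne' hS.ne', one_div,
    Real.log_inv]
  simp only [Finset.sum_add_distrib, Finset.sum_const, Finset.card_univ, Fintype.card_fin,
    nsmul_eq_mul]
  field_simp
  ring

/-- The interpolation of `φ` with the generator `∑ᵢ log rᵢ / n` of the constant portfolio. -/
noncomputable def interpolate (φ : (Fin n → ℝ) → ℝ) (t : ℝ) (r : Fin n → ℝ) : ℝ :=
  (1 - t) * (1 / n * ∑ i, Real.log (r i)) + t * φ r

theorem continuousOn_interpolate (hn : 2 ≤ n) (hφ : ExpConcave φ) (t : ℝ) :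
    ContinuousOn (interpolate φ t) (openSimplex n) := by
  have h := hφ.continuousOn hn
  have h' : ContinuousOn (fun r : Fin n → ℝ => ∑ i, Real.log (r i)) (openSimplex n) :=
    continuousOn_finsetSum _ fun i _ =>
      ContinuousOn.log (by fun_prop) fun r hr => (hr.1 i).1.ne'
  unfold interpolate
  fun_prop

/-- The supporting inequality for `φ_t` with the weights `𝛑_t`. Concavity of the logarithm enters
twice: Jensen's inequality for the uniform weights, then for the mixture of the two supporting sums.
-/
theorem IsSupported.interpolate_sub_le (hn : 2 ≤ n) (hr : r ∈ openSimplex n)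
    (hs : s ∈ openSimplex n) (h : IsSupported φ r) (ht : t ∈ Icc (0 : ℝ) 1) :
    interpolate φ t s - interpolate φ t r
      ≤ Real.log (∑ i, portfolioMapAt φ t r i / r i * s i) := by
  have hn0 : (0 : ℝ) < n := Nat.cast_pos.2 (by omega)
  have : Nonempty (Fin n) := ⟨⟨0, by omega⟩⟩
  set A := ∑ i, portfolioMap φ r i / r i * s i with hA
  set A₀ := ∑ i, (1 / (n : ℝ)) * (s i / r i) with hA₀
  have hApos : 0 < A := (Real.exp_pos _).trans_le (h.le s hs)
  have hA₀pos : 0 < A₀ := Finset.sum_pos (fun i _ => by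
    have := (hr.1 i).1; have := (hs.1 i).1; positivity) Finset.univ_nonempty
  have h1 : φ s - φ r ≤ Real.log A := (Real.le_log_iff_exp_le hApos).2 (h.le s hs)
  have h2 : 1 / n * ∑ i, Real.log (s i) - 1 / n * ∑ i, Real.log (r i) ≤ Real.log A₀ := by
    have := strictConcaveOn_log_Ioi.concaveOn.le_map_sum (t := Finset.univ)
      (w := fun _ : Fin n => 1 / (n : ℝ)) (p := fun i => s i / r i)
      (fun i _ => by positivity) (by simp [hn0.ne'])
      (fun i _ => div_pos (hs.1 i).1 (hr.1 i).1)
    simp only [smul_eq_mul] at this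
    rw [← mul_sub, ← Finset.sum_sub_distrib, Finset.mul_sum]
    refine le_trans (le_of_eq (Finset.sum_congr rfl fun i _ => ?_)) this
    rw [Real.log_div (hs.1 i).1.ne' (hr.1 i).1.ne']
  have h3 := strictConcaveOn_log_Ioi.concaveOn.2 (mem_Ioi.2 hA₀pos) (mem_Ioi.2 hApos)
    (sub_nonneg.2 ht.2) ht.1 (sub_add_cancel 1 t)
  have h4 : ∑ i, portfolioMapAt φ t r i / r i * s i = (1 - t) * A₀ + t * A := by
    rw [hA, hA₀, Finset.mul_sum, Finset.mul_sum, ← Finset.sum_add_distrib]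
    refine Finset.sum_congr rfl fun i _ => ?_
    rw [portfolioMapAt_apply]
    ring
  rw [h4]
  simp only [smul_eq_mul] at h3
  refine le_trans ?_ h3
  simp only [interpolate]
  have h5 := mul_le_mul_of_nonneg_left h1 ht.1
  have h6 := mul_le_mul_of_nonneg_left h2 (sub_nonneg.2 ht.2)
  linarith

/-- The interpolated map attains the minimum that defines the logarithmic conjugate. -/
theorem IsSupported.pairing_le (hn : 2 ≤ n) (hp : p ∈ openSimplex n) (hs : s ∈ openSimplex n)
    (h : IsSupported φ (simplexInv p)) (ht : t ∈ Icc (0 : ℝ) 1)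
    (hT : transportMapAt φ t p ∈ openSimplex n) :
    Real.log (∑ i, simplexInv p i * transportMapAt φ t p i) - interpolate φ t (simplexInv p)
      ≤ Real.log (∑ i, s i * transportMapAt φ t p i) - interpolate φ t s := by
  have hr := simplexInv_mem hn hp
  have hle := h.interpolate_sub_le hn hr hs ht
  have hl : 0 < slopeSum φ t (simplexInv p) :=
    zero_lt_one.trans_le (h.one_le_slopeSum (by omega) hr ht)
  have hq (i : Fin n) : transportMapAt φ t p i =
      portfolioMapAt φ t (simplexInv p) i / simplexInv p i / slopeSum φ t (simplexInv p) := by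
    rw [transportMapAt_eq (by omega) hp]
  have h1 : ∑ i, portfolioMapAt φ t (simplexInv p) i / simplexInv p i * s i
      = slopeSum φ t (simplexInv p) * ∑ i, s i * transportMapAt φ t p i := by
    rw [Finset.mul_sum]
    refine Finset.sum_congr rfl fun i _ => ?_
    rw [hq]
    field_simp
  -- Pairing with `p⁻¹` cancels its coordinates and leaves `∑ 𝛑_t = 1` over the normalizing
  -- constant.
  have h2 : ∑ i, simplexInv p i * transportMapAt φ t p i = (slopeSum φ t (simplexInv p))⁻¹ := by
    rw [← one_div, ← h.sum_portfolioMapAt (by omega) t, Finset.sum_div]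
    refine Finset.sum_congr rfl fun i _ => ?_
    have := (hr.1 i).1.ne'
    rw [hq]
    field_simp
  rw [h1, Real.log_mul hl.ne' (sum_mul_pos_of_mem hs hT).ne'] at hle
  rw [h2, Real.log_inv]
  linarith

/-- A sequence that is dense in the simplex. -/
theorem exists_dense_seq (hn : 2 ≤ n) : ∃ d : ℕ → openSimplex n, DenseRange d := by
  have hb : (fun _ => 1 / (n : ℝ) : Fin n → ℝ) ∈ openSimplex n := by
    rw [mem_openSimplex_iff hn]
    have : (n : ℝ) ≠ 0 := by positivity
    exact ⟨fun i => by positivity, by simp [this]⟩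
  have : Nonempty (openSimplex n) := ⟨⟨_, hb⟩⟩
  exact ⟨TopologicalSpace.denseSeq _, TopologicalSpace.denseRange_denseSeq _⟩

/-- The logarithmic conjugate of `ψ`, as an infimum over a sequence. -/
noncomputable def logConjugate (d : ℕ → openSimplex n) (ψ : (Fin n → ℝ) → ℝ) (q : Fin n → ℝ) : ℝ :=
  ⨅ k, (Real.log (∑ i, (d k : Fin n → ℝ) i * q i) - ψ (d k))

/-- Measurability is the reason for a countable infimum; density and continuity extend its defining
inequality to the whole simplex in `logConjugate_le`. -/
theorem measurable_logConjugate (d : ℕ → openSimplex n) (ψ : (Fin n → ℝ) → ℝ) :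
    Measurable (logConjugate d ψ) :=
  Measurable.iInf fun k => by fun_prop

/-- A lower bound independent of `s`: the infimum in the conjugate is then over a set bounded below,
and not the default value `0`. -/
theorem sum_log_le_log_pairing (hs : s ∈ openSimplex n) (hq : q ∈ openSimplex n) :
    ∑ i, Real.log (q i) ≤ Real.log (∑ i, s i * q i) := by
  refine (Real.le_log_iff_exp_le (sum_mul_pos_of_mem hs hq)).2 ?_
  calc Real.exp (∑ i, Real.log (q i)) = ∑ j, s j * Real.exp (∑ i, Real.log (q i)) := by
        rw [← Finset.sum_mul, hs.2, one_mul]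
    _ ≤ ∑ j, s j * q j := Finset.sum_le_sum fun j _ => by
        refine mul_le_mul_of_nonneg_left ?_ (hs.1 j).1.le
        rw [← Real.le_log_iff_exp_le (hq.1 j).1]
        rw [← Finset.add_sum_erase _ _ (Finset.mem_univ j)]
        exact add_le_of_nonpos_right (Finset.sum_nonpos fun i _ =>
          Real.log_nonpos (hq.1 i).1.le (hq.1 i).2.le)

theorem logConjugate_le {d : ℕ → openSimplex n} (hd : DenseRange d) {ψ : (Fin n → ℝ) → ℝ}
    (hψ : ContinuousOn ψ (openSimplex n)) {C : ℝ} (hC : ∀ s ∈ openSimplex n, ψ s ≤ C)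
    (hr : r ∈ openSimplex n) (hq : q ∈ openSimplex n) :
    logConjugate d ψ q ≤ Real.log (∑ i, r i * q i) - ψ r := by
  have hbdd : BddBelow (range fun k => Real.log (∑ i, (d k : Fin n → ℝ) i * q i) - ψ (d k)) := by
    refine ⟨∑ i, Real.log (q i) - C, ?_⟩
    rintro _ ⟨k, rfl⟩
    exact sub_le_sub (sum_log_le_log_pairing (d k).2 hq) (hC _ (d k).2)
  have hcont : Continuous fun x : openSimplex n =>
      Real.log (∑ i, (x : Fin n → ℝ) i * q i) - ψ x := by
    refine Continuous.sub (Continuous.log ?_ fun x => ?_) hψ.domRestrict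
    · exact continuous_finsetSum _ fun i _ =>
        ((continuous_apply i).comp continuous_subtype_val).mul continuous_const
    · exact (sum_mul_pos_of_mem x.2 hq).ne'
  exact hd.induction_on (p := fun x : openSimplex n =>
    logConjugate d ψ q ≤ Real.log (∑ i, (x : Fin n → ℝ) i * q i) - ψ x) ⟨r, hr⟩
    (isClosed_le continuous_const hcont) fun k => ciInf_le hbdd k

theorem ofReal_integral_le_lintegral_ofReal {α : Type*} [MeasurableSpace α] {μ : Measure α}
    {f : α → ℝ} (hf : Integrable f μ) :
    ENNReal.ofReal (∫ x, f x ∂μ) ≤ ∫⁻ x, ENNReal.ofReal (f x) ∂μ := by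
  rw [integral_eq_lintegral_pos_part_sub_lintegral_neg_part hf]
  exact (ENNReal.ofReal_le_ofReal (sub_le_self _ ENNReal.toReal_nonneg)).trans
    ENNReal.ofReal_toReal_le

/-- A pair of potentials certifies that a map is optimal. -/
theorem lintegral_le_of_isCoupling {P : Measure (Fin n → ℝ)} {T : (Fin n → ℝ) → (Fin n → ℝ)}
    (hT : AEMeasurable T P) {γ : Measure ((Fin n → ℝ) × (Fin n → ℝ))}
    (hγ : IsCoupling P (P.map T) γ) {c : (Fin n → ℝ) → (Fin n → ℝ) → ℝ} {u v : (Fin n → ℝ) → ℝ}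
    (hu : Integrable u P) (hv : Measurable v) (hc : Integrable (fun p => c p (T p)) P)
    (hc0 : ∀ᵐ p ∂P, 0 ≤ c p (T p)) (heq : ∀ᵐ p ∂P, c p (T p) = u p + v (T p))
    (hle : ∀ᵐ z ∂γ, u z.1 + v z.2 ≤ c z.1 z.2) :
    ∫⁻ p, ENNReal.ofReal (c p (T p)) ∂P ≤ ∫⁻ z, ENNReal.ofReal (c z.1 z.2) ∂γ := by
  -- Along the graph `v` is the cost minus `u`, so the conjugate potential needs no integrability
  -- estimate of its own.
  have hvT : Integrable (fun p => v (T p)) P := by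
    refine (hc.sub hu).congr (heq.mono fun p hp => ?_)
    simp [hp]
  have hvQ : Integrable v (P.map T) :=
    (integrable_map_measure hv.aestronglyMeasurable hT).2 hvT
  have hu' : Integrable u (γ.map Prod.fst) := by rw [hγ.1]; exact hu
  have hv' : Integrable v (γ.map Prod.snd) := by rw [hγ.2]; exact hvQ
  have iu : Integrable (fun z : (Fin n → ℝ) × (Fin n → ℝ) => u z.1) γ :=
    hu'.comp_measurable measurable_fst
  have iv : Integrable (fun z : (Fin n → ℝ) × (Fin n → ℝ) => v z.2) γ :=
    hv'.comp_measurable measurable_snd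
  have e1 : ∫ z, u z.1 ∂γ = ∫ p, u p ∂P := by
    rw [← integral_map measurable_fst.aemeasurable hu'.aestronglyMeasurable, hγ.1]
  have e2 : ∫ z, v z.2 ∂γ = ∫ p, v (T p) ∂P := by
    rw [← integral_map measurable_snd.aemeasurable hv'.aestronglyMeasurable, hγ.2,
      integral_map hT hv.aestronglyMeasurable]
  calc ∫⁻ p, ENNReal.ofReal (c p (T p)) ∂P = ENNReal.ofReal (∫ p, c p (T p) ∂P) :=
        (ofReal_integral_eq_lintegral_ofReal hc hc0).symm
    _ = ENNReal.ofReal (∫ z, (u z.1 + v z.2) ∂γ) := by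
        rw [integral_congr_ae heq, integral_add hu hvT, integral_add iu iv, e1, e2]
    _ ≤ ∫⁻ z, ENNReal.ofReal (u z.1 + v z.2) ∂γ := ofReal_integral_le_lintegral_ofReal (iu.add iv)
    _ ≤ _ := lintegral_mono_ae (hle.mono fun z hz => ENNReal.ofReal_le_ofReal hz)

end Duality

/-! ### Integrability from the logarithmic moments. -/

section Integrability

variable {n : ℕ} {φ : (Fin n → ℝ) → ℝ} {p q r : Fin n → ℝ} {P₀ P₁ : Measure (Fin n → ℝ)}

theorem ClassL.integrable_sum_abs_log (h : ClassL P₀) :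
    Integrable (fun p => ∑ i, |Real.log (p i)|) P₀ := by
  refine integrable_finsetSum _ fun i _ => ⟨Measurable.aestronglyMeasurable (by fun_prop), ?_⟩
  have := ENNReal.sum_lt_top.1 h.log_moment i (Finset.mem_univ i)
  rw [hasFiniteIntegral_iff_ofReal (Filter.Eventually.of_forall fun p => abs_nonneg _)]
  exact this

theorem log_sum_inv_le (hn : 2 ≤ n) (hp : p ∈ openSimplex n) :
    Real.log (∑ j, 1 / p j) ≤ Real.log n + ∑ i, |Real.log (p i)| := by
  have hn0 : (0 : ℝ) < n := Nat.cast_pos.2 (by omega)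
  have hS : 0 < ∑ j, 1 / p j := zero_lt_one.trans_le (one_le_sum_inv (by omega) hp)
  rw [Real.log_le_iff_le_exp hS, Real.exp_add, Real.exp_log hn0]
  calc ∑ j, 1 / p j ≤ ∑ _j : Fin n, Real.exp (∑ i, |Real.log (p i)|) :=
        Finset.sum_le_sum fun j _ => by
          rw [← Real.log_le_iff_le_exp (one_div_pos.2 (hp.1 j).1), one_div, Real.log_inv]
          exact (neg_le_abs _).trans (Finset.single_le_sum (f := fun i => |Real.log (p i)|)
            (fun i _ => abs_nonneg _) (Finset.mem_univ j))
    _ = n * Real.exp (∑ i, |Real.log (p i)|) := by simp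

theorem neg_log_simplexInv_le (hn : 2 ≤ n) (hp : p ∈ openSimplex n) (i : Fin n) :
    -Real.log (simplexInv p i) ≤ Real.log n + ∑ i, |Real.log (p i)| := by
  have hS := one_le_sum_inv (by omega) hp
  refine le_trans ?_ (log_sum_inv_le hn hp)
  rw [← Real.log_inv, ← one_div, one_div_simplexInv]
  exact Real.log_le_log (mul_pos (hp.1 i).1 (by linarith))
    (mul_le_of_le_one_left (by linarith) (hp.1 i).2.le)

theorem neg_average_log_simplexInv_le (hn : 2 ≤ n) (hp : p ∈ openSimplex n) :
    -(1 / n * ∑ i, Real.log (simplexInv p i)) ≤ Real.log n + ∑ i, |Real.log (p i)| := by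
  have hn0 : (0 : ℝ) < n := Nat.cast_pos.2 (by omega)
  have h := Finset.sum_le_sum fun i (_ : i ∈ Finset.univ) => neg_log_simplexInv_le hn hp i
  simp only [Finset.sum_neg_distrib, Finset.sum_const, Finset.card_univ, Fintype.card_fin,
    nsmul_eq_mul] at h
  rw [← mul_neg, one_div_mul_eq_div, div_le_iff₀ hn0]
  linarith

theorem average_log_nonpos (hr : r ∈ openSimplex n) : 1 / (n : ℝ) * ∑ i, Real.log (r i) ≤ 0 :=
  mul_nonpos_of_nonneg_of_nonpos (by positivity) (Finset.sum_nonpos fun i _ =>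
    Real.log_nonpos (hr.1 i).1.le (hr.1 i).2.le)

/-- The pairing `⟨p⁻¹, q⟩` is at most `1`, and the `log n` in the estimate for `p⁻¹` cancels the one
in the cost. -/
theorem cost_le_sum_abs_log (hn : 2 ≤ n) (hp : p ∈ openSimplex n) (hq : q ∈ openSimplex n) :
    cost p q ≤ ∑ i, |Real.log (p i)| + ∑ i, |Real.log (q i)| := by
  have hn0 : (0 : ℝ) < n := Nat.cast_pos.2 (by omega)
  have hr := simplexInv_mem hn hp
  have h1 : Real.log (∑ i, simplexInv p i * q i) ≤ 0 :=
    Real.log_nonpos (sum_mul_pos_of_mem hr hq).le (sum_mul_le_one_of_mem hr hq)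
  have h2 := neg_average_log_simplexInv_le hn hp
  have h3 : -(1 / n * ∑ i, Real.log (q i)) ≤ ∑ i, |Real.log (q i)| := by
    rw [← mul_neg, ← Finset.sum_neg_distrib]
    have hs : ∑ i, -Real.log (q i) ≤ ∑ i, |Real.log (q i)| :=
      Finset.sum_le_sum fun i _ => neg_le_abs _
    have hs0 : 0 ≤ ∑ i, |Real.log (q i)| := Finset.sum_nonneg fun i _ => abs_nonneg _
    have hn1 : 1 / (n : ℝ) ≤ 1 := by
      rw [div_le_one hn0]; exact_mod_cast (by omega : 1 ≤ n)
    calc 1 / (n : ℝ) * ∑ i, -Real.log (q i) ≤ 1 / (n : ℝ) * ∑ i, |Real.log (q i)| :=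
          mul_le_mul_of_nonneg_left hs (by positivity)
      _ ≤ _ := mul_le_of_le_one_left hs0 hn1
  rw [cost_eq_log_pairing hn hp hq]
  linarith

/-- An exponentially concave function is bounded above on the simplex. -/
theorem IsSupported.exists_le (h : IsSupported φ r) (hr : r ∈ openSimplex n) :
    ∃ C, 0 ≤ C ∧ ∀ s ∈ openSimplex n, φ s ≤ C := by
  refine ⟨|φ r + Real.log (∑ i, portfolioMap φ r i / r i)|, abs_nonneg _, fun s hs => ?_⟩
  refine le_trans ?_ (le_abs_self _)
  have h1 : Real.exp (φ s - φ r) ≤ ∑ i, portfolioMap φ r i / r i :=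
    (h.le s hs).trans (Finset.sum_le_sum fun i _ =>
      mul_le_of_le_one_right (div_nonneg (h.nonneg i) (hr.1 i).1.le) (hs.1 i).2.le)
  have h2 := (Real.le_log_iff_exp_le ((Real.exp_pos _).trans_le h1)).2 h1
  linarith

/-- Testing the supergradient at `p⁻¹` against a fixed `r` bounds `φ (p⁻¹)` below with only
logarithmic loss; this is the hard half of `integrable_comp_simplexInv`. -/
theorem IsSupported.sub_le_log_sum_inv (hn : 2 ≤ n) (hp : p ∈ openSimplex n)
    (hr : r ∈ openSimplex n) (h : IsSupported φ (simplexInv p)) :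
    φ r - φ (simplexInv p) ≤ Real.log (∑ j, 1 / p j) := by
  have hS : 0 < ∑ j, 1 / p j := zero_lt_one.trans_le (one_le_sum_inv (by omega) hp)
  rw [Real.le_log_iff_exp_le hS]
  refine (h.le r hr).trans ?_
  have hle (i : Fin n) : portfolioMap φ (simplexInv p) i ≤ 1 := by
    rw [← h.sum_eq_one]
    exact Finset.single_le_sum (fun j _ => h.nonneg j) (Finset.mem_univ i)
  calc ∑ i, portfolioMap φ (simplexInv p) i / simplexInv p i * r i
      ≤ ∑ i, p i * ∑ j, 1 / p j := Finset.sum_le_sum fun i _ => by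
        rw [← one_div_simplexInv]
        have h0 := ((simplexInv_mem hn hp).1 i).1
        refine (mul_le_of_le_one_right (div_nonneg (h.nonneg i) h0.le) (hr.1 i).2.le).trans ?_
        exact div_le_div_of_nonneg_right (hle i) h0.le
    _ = ∑ j, 1 / p j := by rw [← Finset.sum_mul, hp.2, one_mul]

theorem continuousOn_simplexInv (hn : 2 ≤ n) :
    ContinuousOn (simplexInv : (Fin n → ℝ) → (Fin n → ℝ)) (openSimplex n) := by
  have h (i : Fin n) : ContinuousOn (fun p : Fin n → ℝ => 1 / p i) (openSimplex n) :=
    ContinuousOn.div (by fun_prop) (by fun_prop) fun p hp => (hp.1 i).1.ne'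
  refine continuousOn_pi.2 fun i => ?_
  refine ContinuousOn.div (h i) (continuousOn_finsetSum _ fun j _ => h j) fun p hp => ?_
  exact (zero_lt_one.trans_le (one_le_sum_inv (by omega) hp)).ne'

theorem aemeasurable_comp_simplexInv (hn : 2 ≤ n) (h₀ : ClassL P₀) {ψ : (Fin n → ℝ) → ℝ}
    (hψ : ContinuousOn ψ (openSimplex n)) : AEMeasurable (fun p => ψ (simplexInv p)) P₀ := by
  have h := (hψ.comp (continuousOn_simplexInv hn) fun p hp => simplexInv_mem hn hp).aemeasurable
    (μ := P₀) (measurableSet_openSimplex n)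
  rwa [Measure.restrict_eq_self_of_ae_mem h₀.ae_mem] at h

theorem integrable_average_log_simplexInv (hn : 2 ≤ n) (h₀ : ClassL P₀) :
    Integrable (fun p => 1 / (n : ℝ) * ∑ i, Real.log (simplexInv p i)) P₀ := by
  have := h₀.isProbabilityMeasure
  refine ((integrable_const (Real.log n)).add h₀.integrable_sum_abs_log).mono' ?_
    (h₀.ae_mem.mono fun p hp => ?_)
  · refine (Measurable.aestronglyMeasurable ?_)
    unfold simplexInv
    fun_prop
  · rw [Real.norm_of_nonpos (average_log_nonpos (simplexInv_mem hn hp))]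
    exact neg_average_log_simplexInv_le hn hp

theorem ClassLa.exists_isSupported (hn : 2 ≤ n) (h₀ : ClassLa P₀) (hφ : ExpConcave φ) :
    ∃ r ∈ openSimplex n, IsSupported φ r := by
  have := h₀.isProbabilityMeasure
  obtain ⟨p, hp, hs⟩ := (h₀.toClassL.ae_mem.and (hφ.ae_isSupported hn h₀)).exists
  exact ⟨simplexInv p, simplexInv_mem hn hp, hs⟩

theorem integrable_comp_simplexInv (hn : 2 ≤ n) (h₀ : ClassLa P₀) (hφ : ExpConcave φ) :
    Integrable (fun p => φ (simplexInv p)) P₀ := by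
  have := h₀.isProbabilityMeasure
  obtain ⟨r, hr, hs⟩ := h₀.exists_isSupported hn hφ
  obtain ⟨C, hC0, hC⟩ := hs.exists_le hr
  have hL := h₀.toClassL.integrable_sum_abs_log
  refine ((integrable_const (C + |φ r| + Real.log n)).add hL).mono'
    (aemeasurable_comp_simplexInv hn h₀.toClassL (hφ.continuousOn hn)).aestronglyMeasurable ?_
  filter_upwards [h₀.toClassL.ae_mem, hφ.ae_isSupported hn h₀] with p hp hsp
  have h1 := hC _ (simplexInv_mem hn hp)
  have h2 := (hsp.sub_le_log_sum_inv hn hp hr).trans (log_sum_inv_le hn hp)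
  have h3 : 0 ≤ ∑ i, |Real.log (p i)| := Finset.sum_nonneg fun i _ => abs_nonneg _
  have h4 : 0 ≤ Real.log n := Real.log_natCast_nonneg n
  rw [Real.norm_eq_abs, abs_le]
  simp only [Pi.add_apply]
  exact ⟨by linarith [neg_abs_le (φ r)], by linarith [abs_nonneg (φ r)]⟩

end Integrability

/-! ### The transport cost as an explicit integral. -/

section Main

variable {n : ℕ} {φ : (Fin n → ℝ) → ℝ} {p : Fin n → ℝ} {t : ℝ} {P₀ P₁ : Measure (Fin n → ℝ)}

/-- The weights generated by `φ` at the inverse of `p`, relative to the barycenter. -/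
noncomputable def relativeWeight (φ : (Fin n → ℝ) → ℝ) (p : Fin n → ℝ) : Fin n → ℝ :=
  fun i => n * portfolioMap φ (simplexInv p) i - 1

theorem one_add_mul_relativeWeight (hn : 1 ≤ n) (t : ℝ) (i : Fin n) :
    1 + t * relativeWeight φ p i = n * portfolioMapAt φ t (simplexInv p) i := by
  have : (n : ℝ) ≠ 0 := by positivity
  rw [portfolioMapAt_apply, relativeWeight]
  field_simp
  ring

/-- Support gives only nonnegative weights. They are positive because a zero weight would put `T p`
on the boundary; this makes the logarithms meaningful up to `t = 1`. -/
theorem IsSupported.isRelativeWeight (hn : 2 ≤ n)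
    (h : IsSupported φ (simplexInv p)) (hT : transportMap φ p ∈ openSimplex n) :
    IsRelativeWeight (relativeWeight φ p) := by
  have hn0 : (0 : ℝ) < n := Nat.cast_pos.2 (by omega)
  refine ⟨fun i => ?_, ?_⟩
  · have hne : portfolioMap φ (simplexInv p) i ≠ 0 := fun h0 => by
      have := (hT.1 i).1
      simp [transportMap, perturb, h0] at this
    have hpos := (h.nonneg i).lt_of_ne' hne
    have := mul_pos hn0 hpos
    unfold relativeWeight
    linarith
  · simp only [relativeWeight, Finset.sum_sub_distrib, ← Finset.mul_sum, h.sum_eq_one]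
    simp

theorem IsRelativeWeight.portfolioMapAt_pos (hn : 1 ≤ n)
    (hw : IsRelativeWeight (relativeWeight φ p)) (ht : t ∈ Icc (0 : ℝ) 1) (i : Fin n) :
    0 < portfolioMapAt φ t (simplexInv p) i := by
  have h := hw.one_add_pos ht i
  rw [one_add_mul_relativeWeight hn] at h
  exact pos_of_mul_pos_right h (Nat.cast_nonneg n)

/-- The ratios `q_i / p_i` are `𝛑_t` divided by the common factor `D`, whose logarithm cancels in
the cost; what remains depends on the weights alone. -/
theorem cost_transportMapAt (hn : 2 ≤ n) (hp : p ∈ openSimplex n)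
    (h : IsSupported φ (simplexInv p)) (hw : IsRelativeWeight (relativeWeight φ p))
    (ht : t ∈ Icc (0 : ℝ) 1) :
    cost p (transportMapAt φ t p) = entropyAlong (relativeWeight φ p) t := by
  have hn0 : (n : ℝ) ≠ 0 := by positivity
  have hpi := hw.portfolioMapAt_pos (by omega) ht
  have hD := sum_mul_pos_of_sum_eq_one (fun i => (hp.1 i).1) (fun i => (hpi i).le)
    (h.sum_portfolioMapAt (by omega) t)
  set D := ∑ j, p j * portfolioMapAt φ t (simplexInv p) j with hDdef
  have hq (i : Fin n) : transportMapAt φ t p i / p i = portfolioMapAt φ t (simplexInv p) i / D := by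
    have := (hp.1 i).1.ne'
    simp only [transportMapAt, perturb, ← hDdef]
    field_simp
  simp only [cost, entropyAlong, hq, one_add_mul_relativeWeight (show 1 ≤ n by omega)]
  rw [← Finset.sum_div, h.sum_portfolioMapAt (by omega) t,
    Finset.sum_congr rfl fun i _ => Real.log_div (hpi i).ne' hD.ne',
    Finset.sum_congr rfl fun i _ => Real.log_mul hn0 (hpi i).ne',
    Real.log_mul (by positivity) (by positivity), one_div, one_div, Real.log_inv, Real.log_inv]
  simp only [Finset.sum_sub_distrib, Finset.sum_add_distrib, Finset.sum_const, Finset.card_univ,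
    Fintype.card_fin, nsmul_eq_mul]
  field_simp
  ring

theorem measurable_cost : Measurable fun z : (Fin n → ℝ) × (Fin n → ℝ) => cost z.1 z.2 := by
  unfold cost
  fun_prop

theorem GeneratesOptimalTransport.ae_isRelativeWeight (hn : 2 ≤ n) (h₀ : ClassLa P₀)
    (h₁ : ClassLa P₁) (hφ : GeneratesOptimalTransport φ P₀ P₁) :
    ∀ᵐ p ∂P₀, IsRelativeWeight (relativeWeight φ p) := by
  have hT : ∀ᵐ p ∂P₀, transportMap φ p ∈ openSimplex n := by
    refine ae_of_ae_map hφ.aemeasurable ?_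
    rw [hφ.map_eq]
    exact h₁.toClassL.ae_mem
  filter_upwards [hφ.expConcave.ae_isSupported hn h₀, hT] with p hs hq
    using hs.isRelativeWeight hn hq

theorem GeneratesOptimalTransport.aemeasurable_relativeWeight (hn : 2 ≤ n) (h₀ : ClassLa P₀)
    (hφ : GeneratesOptimalTransport φ P₀ P₁) : AEMeasurable (relativeWeight φ) P₀ := by
  have h := aemeasurable_portfolioMap hn h₀ hφ.expConcave hφ.aemeasurable
  refine aemeasurable_pi_lambda _ fun i => ?_
  have hi : AEMeasurable (fun p => portfolioMap φ (simplexInv p) i) P₀ :=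
    (measurable_pi_apply i).comp_aemeasurable h
  exact (hi.const_mul _).sub_const _

theorem GeneratesOptimalTransport.integrable_entropyAlong_one (hn : 2 ≤ n) (h₀ : ClassLa P₀)
    (h₁ : ClassLa P₁) (hφ : GeneratesOptimalTransport φ P₀ P₁) :
    Integrable (fun p => entropyAlong (relativeWeight φ p) 1) P₀ := by
  have hX := hφ.aemeasurable_relativeWeight hn h₀
  have hL₁ : Integrable (fun p => ∑ i, |Real.log (transportMap φ p i)|) P₀ := by
    have h := h₁.toClassL.integrable_sum_abs_log
    rw [← hφ.map_eq] at h
    exact h.comp_aemeasurable hφ.aemeasurable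
  have hT : ∀ᵐ p ∂P₀, transportMap φ p ∈ openSimplex n := by
    refine ae_of_ae_map hφ.aemeasurable ?_
    rw [hφ.map_eq]
    exact h₁.toClassL.ae_mem
  have h1 : (1 : ℝ) ∈ Icc (0 : ℝ) 1 := right_mem_Icc.2 zero_le_one
  refine (h₀.toClassL.integrable_sum_abs_log.add hL₁).mono' ?_ ?_
  · have (i : Fin n) : AEMeasurable (fun p => relativeWeight φ p i) P₀ :=
      (measurable_pi_apply i).comp_aemeasurable hX
    unfold entropyAlong
    exact AEMeasurable.aestronglyMeasurable (by fun_prop)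
  · filter_upwards [h₀.toClassL.ae_mem, hφ.expConcave.ae_isSupported hn h₀,
      hφ.ae_isRelativeWeight hn h₀ h₁, hT] with p hp hs hw hq
    rw [Real.norm_of_nonneg (hw.entropyAlong_nonneg h1), ← cost_transportMapAt hn hp hs hw h1,
      transportMapAt_one]
    exact cost_le_sum_abs_log hn hp hq

/-- The maps `Tₜ` are optimal. -/
theorem GeneratesOptimalTransport.transportCost_eq (hn : 2 ≤ n) (h₀ : ClassLa P₀)
    (h₁ : ClassLa P₁) (hφ : GeneratesOptimalTransport φ P₀ P₁) (ht : t ∈ Icc (0 : ℝ) 1)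
    (hPt : ClassL (P₀.map (transportMapAt φ t))) :
    transportCost P₀ (P₀.map (transportMapAt φ t)) =
      ENNReal.ofReal (∫ p, entropyAlong (relativeWeight φ p) t ∂P₀) := by
  have hexp := hφ.expConcave
  have hX := hφ.aemeasurable_relativeWeight hn h₀
  have hw := hφ.ae_isRelativeWeight hn h₀ h₁
  have hint := integrable_entropyAlong hX hw (hφ.integrable_entropyAlong_one hn h₀ h₁) ht
  have hTm := aemeasurable_transportMapAt hn h₀ hexp hφ.aemeasurable t
  have hm := h₀.toClassL.ae_mem
  have hs := hexp.ae_isSupported hn h₀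
  have hcost : ∀ᵐ p ∂P₀, cost p (transportMapAt φ t p) = entropyAlong (relativeWeight φ p) t := by
    filter_upwards [hm, hs, hw] with p h1 h2 h3 using cost_transportMapAt hn h1 h2 h3 ht
  have hTmem : ∀ᵐ p ∂P₀, transportMapAt φ t p ∈ openSimplex n := ae_of_ae_map hTm hPt.ae_mem
  have hcost0 : ∀ᵐ p ∂P₀, 0 ≤ cost p (transportMapAt φ t p) := by
    filter_upwards [hcost, hw] with p h1 h2
    rw [h1]; exact h2.entropyAlong_nonneg ht
  have hcint : Integrable (fun p => cost p (transportMapAt φ t p)) P₀ :=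
    hint.congr (hcost.mono fun p hp => hp.symm)
  have hval : ∫⁻ p, ENNReal.ofReal (cost p (transportMapAt φ t p)) ∂P₀ =
      ENNReal.ofReal (∫ p, entropyAlong (relativeWeight φ p) t ∂P₀) := by
    rw [← ofReal_integral_eq_lintegral_ofReal hcint hcost0, integral_congr_ae hcost]
  rw [← hval]
  refine le_antisymm ?_ ?_
  -- Upper bound: the coupling carried by the graph of `T_t`.
  · have hg : AEMeasurable (fun p => (p, transportMapAt φ t p)) P₀ := aemeasurable_id.prodMk hTm
    refine (iInf₂_le (P₀.map fun p => (p, transportMapAt φ t p)) ⟨?_, ?_⟩).trans_eq ?_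
    · rw [lintegral_map' measurable_cost.ennreal_ofReal.aemeasurable hg]
    · rw [AEMeasurable.map_map_of_aemeasurable measurable_fst.aemeasurable hg]
      exact Measure.map_id
    · rw [AEMeasurable.map_map_of_aemeasurable measurable_snd.aemeasurable hg]
      rfl
  -- Lower bound: the potentials are `φ_t` at `p⁻¹` and its logarithmic conjugate, corrected by the
  -- one-variable terms of the cost.
  · refine le_iInf₂ fun γ hγ => ?_
    obtain ⟨d, hd⟩ := exists_dense_seq hn
    have hψ := continuousOn_interpolate hn hexp t
    obtain ⟨C, hC⟩ : ∃ C, ∀ s ∈ openSimplex n, interpolate φ t s ≤ C := by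
      obtain ⟨r, hr, hr'⟩ := h₀.exists_isSupported hn hexp
      obtain ⟨C, hC0, hC⟩ := hr'.exists_le hr
      refine ⟨C, fun s hs => ?_⟩
      have h1 := mul_nonpos_of_nonneg_of_nonpos (sub_nonneg.2 ht.2) (average_log_nonpos hs)
      have h2 := mul_le_mul_of_nonneg_left (hC s hs) ht.1
      have h3 := mul_le_of_le_one_left hC0 ht.2
      unfold interpolate
      linarith
    have hiu : Integrable (fun p => interpolate φ t (simplexInv p) - Real.log n
        - 1 / n * ∑ i, Real.log (simplexInv p i)) P₀ := by
      have := h₀.isProbabilityMeasure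
      have ha := integrable_average_log_simplexInv hn h₀.toClassL
      exact (((ha.const_mul (1 - t)).add ((integrable_comp_simplexInv hn h₀ hexp).const_mul t)).sub
        (integrable_const _)).sub ha
    refine lintegral_le_of_isCoupling hTm hγ (c := cost) hiu
      (v := fun q => logConjugate d (interpolate φ t) q - 1 / n * ∑ i, Real.log (q i)) ?_
      hcint hcost0 ?_ ?_
    · have := measurable_logConjugate d (interpolate φ t)
      fun_prop
    · filter_upwards [hm, hs, hTmem] with p hp hsp hq
      have hle := logConjugate_le hd hψ hC (simplexInv_mem hn hp) hq
      have hge : Real.log (∑ i, simplexInv p i * transportMapAt φ t p i)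
          - interpolate φ t (simplexInv p)
            ≤ logConjugate d (interpolate φ t) (transportMapAt φ t p) :=
        -- The infimum is at least the value at `p⁻¹`, although `p⁻¹` need not belong to the dense
        -- sequence; together with `hle` this gives tightness along `T_t`.
        le_ciInf fun k => hsp.pairing_le hn hp (d k).2 ht hq
      rw [cost_eq_log_pairing hn hp hq]
      linarith
    · have hz1 : ∀ᵐ z ∂γ, z.1 ∈ openSimplex n := by
        refine ae_of_ae_map measurable_fst.aemeasurable ?_
        rw [hγ.1]; exact hm
      have hz2 : ∀ᵐ z ∂γ, z.2 ∈ openSimplex n := by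
        refine ae_of_ae_map measurable_snd.aemeasurable ?_
        rw [hγ.2]; exact hPt.ae_mem
      filter_upwards [hz1, hz2] with z hp hq
      have hle := logConjugate_le hd hψ hC (simplexInv_mem hn hp) hq
      rw [cost_eq_log_pairing hn hp hq]
      linarith

theorem GeneratesOptimalTransport.classLa_map (hn : 2 ≤ n) (h₀ : ClassLa P₀) (h₁ : ClassLa P₁)
    (hφ : GeneratesOptimalTransport φ P₀ P₁) (ht : t ∈ Icc (0 : ℝ) 1) :
    ClassLa (P₀.map (transportMapAt φ t)) := by
  rcases ht.2.eq_or_lt with rfl | h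
  · rw [transportMapAt_one, hφ.map_eq]; exact h₁
  · exact classLa_map_transportMapAt hn h₀ hφ.expConcave hφ.aemeasurable ⟨ht.1, h⟩

/-- Uniform weights act trivially, `p ⊙ e̅ = p`, so the transport map is the identity almost
everywhere. -/
theorem GeneratesOptimalTransport.eq_of_relativeWeight_eq_zero (hn : 2 ≤ n) (h₀ : ClassLa P₀)
    (hφ : GeneratesOptimalTransport φ P₀ P₁) (h : ∀ᵐ p ∂P₀, relativeWeight φ p = 0) :
    P₀ = P₁ := by
  have hn0 : (n : ℝ) ≠ 0 := by positivity
  rw [← hφ.map_eq]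
  nth_rewrite 1 [← Measure.map_id (μ := P₀)]
  refine Measure.map_congr ?_
  filter_upwards [h, h₀.toClassL.ae_mem] with p hp hm
  have hw (i : Fin n) : portfolioMap φ (simplexInv p) i = 1 / n := by
    have := congrFun hp i
    simp only [relativeWeight, Pi.zero_apply] at this
    field_simp
    linarith
  funext i
  simp only [transportMap, perturb, hw, id]
  rw [← Finset.sum_mul, hm.2]
  field_simp

end Main

end DirichletTransport

theorem proposition6 (n : ℕ) (hn : 2 ≤ n) (P₀ P₁ : Measure (Fin n → ℝ))
    (h₀ : ClassLa P₀) (h₁ : ClassLa P₁) (P : ℝ → Measure (Fin n → ℝ))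
    (hP : IsDisplacementInterpolation P₀ P₁ P) :
    (∀ t ∈ Icc (0 : ℝ) 1, ClassLa (P t)) ∧
    (∀ t ∈ Icc (0 : ℝ) 1, transportCost P₀ (P t) ≠ ⊤) ∧
    (P₀ ≠ P₁ →
      ContDiffOn ℝ (⊤ : ℕ∞) (fun t => (transportCost P₀ (P t)).toReal) (Ico 0 1) ∧
      ContinuousOn (fun t => (transportCost P₀ (P t)).toReal) (Icc 0 1) ∧
      StrictMonoOn (fun t => (transportCost P₀ (P t)).toReal) (Icc 0 1) ∧
      StrictConvexOn ℝ (Icc 0 1) (fun t => (transportCost P₀ (P t)).toReal)) := by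
  obtain ⟨φ, hφ, hPt⟩ := hP
  have := h₀.isProbabilityMeasure
  have hX := hφ.aemeasurable_relativeWeight hn h₀
  have hw := hφ.ae_isRelativeWeight hn h₀ h₁
  have hint := hφ.integrable_entropyAlong_one hn h₀ h₁
  have hcost : ∀ t ∈ Icc (0 : ℝ) 1, transportCost P₀ (P t) =
      ENNReal.ofReal (∫ p, entropyAlong (relativeWeight φ p) t ∂P₀) := fun t ht => by
    rw [hPt t ht]
    exact hφ.transportCost_eq hn h₀ h₁ ht (hφ.classLa_map hn h₀ h₁ ht).toClassL
  have hnn : ∀ t ∈ Icc (0 : ℝ) 1, 0 ≤ ∫ p, entropyAlong (relativeWeight φ p) t ∂P₀ :=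
    fun t ht => integral_nonneg_of_ae (hw.mono fun p hp => hp.entropyAlong_nonneg ht)
  have heq : EqOn (fun t => ∫ p, entropyAlong (relativeWeight φ p) t ∂P₀)
      (fun t => (transportCost P₀ (P t)).toReal) (Icc 0 1) := fun t ht => by
    simp only [hcost t ht, ENNReal.toReal_ofReal (hnn t ht)]
  refine ⟨fun t ht => ?_, fun t ht => ?_, fun hne => ⟨?_, ?_, ?_, ?_⟩⟩
  · rw [hPt t ht]
    exact hφ.classLa_map hn h₀ h₁ ht
  · rw [hcost t ht]
    exact ENNReal.ofReal_ne_top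
  · exact (contDiffOn_integral_entropyAlong (by omega) hX hw).congr fun t ht =>
      (heq (Ico_subset_Icc_self ht)).symm
  · exact (continuousOn_integral_entropyAlong hX hw hint).congr fun t ht => (heq ht).symm
  · have hsc := strictConvexOn_integral_entropyAlong hX hw hint
      fun h => hne (hφ.eq_of_relativeWeight_eq_zero hn h₀ h)
    exact (strictMonoOn_of_strictConvexOn_of_nonneg hsc (by simp [entropyAlong_zero]) hnn).congr heq
  · exact (strictConvexOn_integral_entropyAlong hX hw hint
      fun h => hne (hφ.eq_of_relativeWeight_eq_zero hn h₀ h)).congr heq
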